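/- Let $b>0$, $q>0$, $n\in\mathbb N=\{0,1,2,\dots\}$, and write $\langle x\rangle=\sqrt{1+\|x\|^2}$ for a vector or a real number $x$. Let $H_L=\frac12(-i\nabla-bA_L)^2$ with $A_L(x)=\frac12(-x_2,x_1)$ be the Landau Hamiltonian in $L^2(\mathbb R^2)$, i.e. the closure of this expression on $C_c^\infty(\mathbb R^2)$, and let $P_n$ be the orthogonal projection onto the $n$-th Landau level, the eigenspace of $H_L$ for the eigenvalue $E_n=\frac b2(2n+1)$. Put $W_n=P_n e^{-q\langle X\rangle}P_n$, where $e^{-q\langle X\rangle}$ is multiplication by $x\mapsto e^{-q\langle x\rangle}$. For integers $k\ge -n$ let $$\varphi_{n,k}(x)=\sqrt{\tfrac{n!}{(k+n)!}}\Big[\sqrt{\tfrac b2}(x_1+ix_2)\Big]^k L_n^{(k)}\Big(\tfrac{b\|x\|^2}{2}\Big)\sqrt{\tfrac b{2\pi}}\,e^{-b\|x\|^2/4},\qquad L_n^{(\alpha)}(\xi)=\sum_{m=0}^n\binom{n+\alpha}{n-m}\frac{(-\xi)^m}{m!},$$ where $\binom{\alpha}{m}=\alpha(\alpha-1)\cdots(\alpha-m+1)/m!$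 (for $k<0$ the formula for $\varphi_{n,k}$ is read for almost every $x$). Then every $\varphi_{n,k}$ is in $L^2(\mathbb R^2)$ and $W_n\varphi_{n,k}=\lambda_{n,k}\varphi_{n,k}$, with $$\lambda_{n,k}=\frac{n!}{(k+n)!}\int_0^\infty e^{-q\langle\sqrt{2\xi/b}\rangle}e^{-\xi}\xi^kL_n^{(k)}(\xi)^2\,d\xi,\qquad k\ge -n,$$ where the integrals converge, and $\{\varphi_{n,k}\}_{k\ge -n}$ is an ultra-generalized Wannier basis (UGWB) for $\operatorname{Ran}P_n$. Here a UGWB, with parameter $q$, for the range of an orthogonal projection $P$ of infinite rank on $L^2(\mathbb R^d)$ means the following. First, $P$ is exponentially localized with some rate $\beta>q$: it is an integral operator with a measurable kernel satisfying $|P(x,y)|\le Ce^{-\beta\|x-y\|}$. Second, the family can be listed as $\{\psi_{i,j}\}_{i\in\mathbb N,\,1\le j\le m_i}$ with $1\le m_i<\infty$, it is an orthonormal basis of $\operatorname{Ran}P$, and $Pe^{-q\langle X\rangle}P\,\psi_{i,j}=\lambda_i\psi_{i,j}$ with $\lambda_0>\lambda_1>\dots>0$ and $\lambda_i\to0$.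 Third, each $\psi_{i,j}$ decays exponentially with rate $q$, i.e. $e^{q\langle x\rangle}\psi_{i,j}\in L^2$. Fourth, with $r_i=\sqrt{(\ln(\lambda_i)/q)^2-1}$, $$\sup_{i,j}\int_{\mathbb R^d}e^{q|\langle x\rangle-\langle r_i\rangle|}\,|\psi_{i,j}(x)|^2\,dx<\infty .$$ -/

import Mathlib

open MeasureTheory Filter Topology
open scoped ENNReal ContDiff InnerProductSpace

namespace Landau

noncomputable section

/-- The Euclidean space `ℝ^d`, with its Euclidean norm and Lebesgue measure. -/
abbrev Space (d : ℕ) : Type := EuclideanSpace ℝ (Fin d)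

/-- The Hilbert space `L²(ℝ^d)` of complex-valued functions. -/
abbrev L2 (d : ℕ) : Type := Lp ℂ 2 (volume : Measure (Space d))

/-- The Japanese bracket `⟨x⟩ = √(1 + ‖x‖²)`, of a vector or of a real number. -/
def bracket {E : Type*} [Norm E] (x : E) : ℝ := √(1 + ‖x‖ ^ 2)

theorem continuous_bracket {E : Type*} [SeminormedAddGroup E] :
    Continuous (bracket : E → ℝ) := by
  unfold bracket
  fun_prop

/-! ### The operator `P e^{-q⟨X⟩} P` -/

/-- The function `x ↦ e^{-q⟨x⟩}`, with values in `ℂ`. -/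
def expWeight {d : ℕ} (q : ℝ) (x : Space d) : ℂ := (Real.exp (-q * bracket x) : ℝ)

theorem memLp_expWeight {d : ℕ} {q : ℝ} (hq : 0 < q) :
    MemLp (expWeight q : Space d → ℂ) ∞ volume := by
  refine memLp_top_of_bound (C := 1) ?_ (Eventually.of_forall fun x => ?_)
  · apply Continuous.aestronglyMeasurable
    have h : Continuous (bracket : Space d → ℝ) := continuous_bracket
    unfold expWeight
    fun_prop
  · have hb : 0 ≤ bracket x := Real.sqrt_nonneg _
    rw [expWeight, Complex.norm_real, Real.norm_eq_abs, Real.abs_exp, Real.exp_le_one_iff]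
    nlinarith

/-- The bounded operator `e^{-q⟨X⟩}` on `L²(ℝ^d)`: multiplication by `x ↦ e^{-q⟨x⟩}`. -/
def expMul {d : ℕ} (q : ℝ) (hq : 0 < q) : L2 d →L[ℂ] L2 d :=
  (ContinuousLinearMap.mul ℂ ℂ).holderL volume ∞ 2 2 (memLp_expWeight hq).toLp

theorem coeFn_expMul {d : ℕ} {q : ℝ} (hq : 0 < q) (ψ : L2 d) :
    (expMul q hq ψ : Space d → ℂ) =ᵐ[volume]
      fun x => (Real.exp (-q * bracket x) : ℂ) * (ψ : Space d → ℂ) x := by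
  have h1 := (ContinuousLinearMap.mul ℂ ℂ).coeFn_holder (r := 2)
    (memLp_expWeight (d := d) hq).toLp ψ
  have h2 := (memLp_expWeight (d := d) hq).coeFn_toLp
  filter_upwards [h1, h2] with x h1 h2
  refine h1.trans ?_
  rw [h2]
  simp [expWeight]

/-- The operator `W = P e^{-q⟨X⟩} P`. -/
def sandwich {d : ℕ} (q : ℝ) (hq : 0 < q) (P : L2 d →L[ℂ] L2 d) : L2 d →L[ℂ] L2 d :=
  P ∘L expMul q hq ∘L P

/-! ### Ultra-generalized Wannier bases -/

/-- `P` is an integral operator with a measurable kernel `K` such that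
`|K(x, y)| ≤ C e^{-β‖x - y‖}` for all `x, y`. -/
def IsExpLocalized {d : ℕ} (β : ℝ) (P : L2 d →L[ℂ] L2 d) : Prop :=
  0 < β ∧ ∃ K : Space d × Space d → ℂ, Measurable K ∧
    (∃ C : ℝ, 0 < C ∧ ∀ x y, ‖K (x, y)‖ ≤ C * Real.exp (-β * ‖x - y‖)) ∧
    ∀ ψ : L2 d, (P ψ : Space d → ℂ) =ᵐ[volume] fun x => ∫ y, K (x, y) * (ψ : Space d → ℂ) y

/-- The localization radius `r = √((ln λ / q)² - 1)` attached to an eigenvalue `λ`. -/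
def locRadius (q lam : ℝ) : ℝ := √((Real.log lam / q) ^ 2 - 1)

/-- The family `Φ` is an ultra-generalized Wannier basis (for the parameter `q > 0`) of the range
of the (infinite-rank) orthogonal projection `P`, where `P` is exponentially localized with a rate
larger than `q`: listed as `ψ i j`, `j < m i < ∞`, it is an orthonormal basis of `Ran P` made of
eigenfunctions of `P e^{-q⟨X⟩} P`, where `ψ i j` belongs to the eigenvalue `lam i`; the eigenvalues
`lam i` are positive and pairwise distinct, are listed in decreasing order and tend to `0`
(hence `m i` is the multiplicity of `lam i`); every `ψ i j` decays exponentially with rate `q`; and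
the `ψ i j` are, uniformly in `i, j`, localized around the spheres of radius `r i`. -/
def IsUGWB {d : ℕ} {ι : Type*} (q : ℝ) (hq : 0 < q) (P : L2 d →L[ℂ] L2 d) (Φ : ι → L2 d) : Prop :=
  IsStarProjection P ∧ (∃ β, q < β ∧ IsExpLocalized β P) ∧
  ∃ (lam : ℕ → ℝ) (m : ℕ → ℕ) (e : (Σ i : ℕ, Fin (m i)) ≃ ι) (ψ : (i : ℕ) → Fin (m i) → L2 d),
    (∀ i j, ψ i j = Φ (e ⟨i, j⟩)) ∧
    (∀ i, 0 < m i) ∧ (∀ i, 0 < lam i) ∧ StrictAnti lam ∧ Tendsto lam atTop (𝓝 0) ∧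
    Orthonormal ℂ Φ ∧
    (Submodule.span ℂ (Set.range Φ)).topologicalClosure = P.range ∧
    (∀ i j, sandwich q hq P (ψ i j) = (lam i : ℂ) • ψ i j) ∧
    (∀ i j, MemLp (fun x => (Real.exp (q * bracket x) : ℂ) * (ψ i j : Space d → ℂ) x) 2 volume) ∧
    ∃ M : ℝ, ∀ i j,
      ∫⁻ x, ENNReal.ofReal (Real.exp (q * |bracket x - bracket (locRadius q (lam i))|) *
        ‖(ψ i j : Space d → ℂ) x‖ ^ 2) ≤ ENNReal.ofReal M

/-! ### The Landau Hamiltonian in the symmetric gauge -/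

/-- The vector potential `A(x) = ½ (-x₂, x₁)`. -/
def vectorPotential (x : Space 2) : Fin 2 → ℝ := ![-(x 1) / 2, x 0 / 2]

/-- The components `-i ∂_j - b A_j` of the magnetic momentum, acting on (smooth) functions. -/
def momentum (b : ℝ) (j : Fin 2) (f : Space 2 → ℂ) (x : Space 2) : ℂ :=
  -Complex.I * fderiv ℝ f x (EuclideanSpace.single j 1) - (b * vectorPotential x j : ℝ) * f x

/-- The differential expression `½ (-i∇ - bA)²`, acting on (smooth) functions. -/
def landauExpr (b : ℝ) (f : Space 2 → ℂ) (x : Space 2) : ℂ :=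
  (1 / 2 : ℂ) * ∑ j : Fin 2, momentum b j (momentum b j f) x

theorem contDiff_vectorPotential (j : Fin 2) : ContDiff ℝ ∞ fun x => vectorPotential x j := by
  fin_cases j <;> simp [vectorPotential] <;> fun_prop

theorem contDiff_momentum (b : ℝ) (j : Fin 2) {f : Space 2 → ℂ} (hf : ContDiff ℝ ∞ f) :
    ContDiff ℝ ∞ (momentum b j f) := by
  have h1 : ContDiff ℝ ∞ (fderiv ℝ f) := hf.fderiv_right (by simp)
  have h2 := contDiff_vectorPotential j
  have h3 : ContDiff ℝ ∞ fun x => ((b * vectorPotential x j : ℝ) : ℂ) :=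
    Complex.ofRealCLM.contDiff.comp (contDiff_const.mul h2)
  unfold momentum
  exact (contDiff_const.mul (h1.clm_apply contDiff_const)).sub (h3.mul hf)

theorem momentum_add (b : ℝ) (j : Fin 2) {f g : Space 2 → ℂ} (hf : ContDiff ℝ ∞ f)
    (hg : ContDiff ℝ ∞ g) : momentum b j (f + g) = momentum b j f + momentum b j g := by
  ext x
  have h1 := (hf.differentiable (by simp)) x
  have h2 := (hg.differentiable (by simp)) x
  simp only [momentum, Pi.add_apply, fderiv_add h1 h2, _root_.add_apply]
  ring

theorem momentum_smul (b : ℝ) (j : Fin 2) (c : ℂ) {f : Space 2 → ℂ} (hf : ContDiff ℝ ∞ f) :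
    momentum b j (c • f) = c • momentum b j f := by
  ext x
  have h1 := (hf.differentiable (by simp)) x
  simp only [momentum, Pi.smul_apply, fderiv_const_smul h1, _root_.smul_apply,
    smul_eq_mul]
  ring

theorem landauExpr_add (b : ℝ) {f g : Space 2 → ℂ} (hf : ContDiff ℝ ∞ f)
    (hg : ContDiff ℝ ∞ g) : landauExpr b (f + g) = landauExpr b f + landauExpr b g := by
  ext x
  simp only [landauExpr, Pi.add_apply, momentum_add b _ hf hg,
    momentum_add b _ (contDiff_momentum b _ hf) (contDiff_momentum b _ hg),
    Finset.sum_add_distrib]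
  ring

theorem landauExpr_smul (b : ℝ) (c : ℂ) {f : Space 2 → ℂ} (hf : ContDiff ℝ ∞ f) :
    landauExpr b (c • f) = c • landauExpr b f := by
  ext x
  simp only [landauExpr, Pi.smul_apply, momentum_smul b _ c hf,
    momentum_smul b _ c (contDiff_momentum b _ hf), smul_eq_mul, ← Finset.mul_sum]
  ring

/-- The graph in `L²(ℝ²) × L²(ℝ²)` of the minimal operator: the expression `½ (-i∇ - bA)²` on the
domain `C_c^∞(ℝ²)`. -/
def minimalGraph (b : ℝ) : Submodule ℂ (L2 2 × L2 2) where
  carrier := {p | ∃ f : Space 2 → ℂ, ContDiff ℝ ∞ f ∧ HasCompactSupport f ∧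
    (p.1 : Space 2 → ℂ) =ᵐ[volume] f ∧ (p.2 : Space 2 → ℂ) =ᵐ[volume] landauExpr b f}
  zero_mem' := by
    refine ⟨0, contDiff_const, HasCompactSupport.zero, Lp.coeFn_zero _ _ _, ?_⟩
    have h : landauExpr b 0 = 0 := by
      simpa using landauExpr_smul b 0 (f := 0) contDiff_const
    rw [h]
    exact Lp.coeFn_zero _ _ _
  add_mem' := by
    rintro p p' ⟨f, hf, hfc, h1, h2⟩ ⟨g, hg, hgc, h3, h4⟩
    refine ⟨f + g, hf.add hg, hfc.add hgc, (Lp.coeFn_add _ _).trans (h1.add h3), ?_⟩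
    rw [landauExpr_add b hf hg]
    exact (Lp.coeFn_add _ _).trans (h2.add h4)
  smul_mem' := by
    rintro c p ⟨f, hf, hfc, h1, h2⟩
    refine ⟨c • f, hf.const_smul c, hfc.smul_left (f := fun _ => c),
      (Lp.coeFn_smul _ _).trans (h1.const_smul c), ?_⟩
    rw [landauExpr_smul b c hf]
    exact (Lp.coeFn_smul _ _).trans (h2.const_smul c)

/-- The graph of the Landau Hamiltonian, the self-adjoint operator which is the closure of the
essentially self-adjoint minimal operator: `(ψ, χ)` is in it iff `ψ` is in the domain and
`H ψ = χ`. -/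
def hamiltonianGraph (b : ℝ) : Submodule ℂ (L2 2 × L2 2) := (minimalGraph b).topologicalClosure

/-- The `n`-th Landau energy `E_n = (b / 2) (2 n + 1)`. -/
def energy (b : ℝ) (n : ℕ) : ℝ := b / 2 * (2 * n + 1)

/-- The `n`-th Landau level: the eigenspace `{ψ | ψ ∈ dom H, H ψ = E_n ψ}`. -/
def level (b : ℝ) (n : ℕ) : Submodule ℂ (L2 2) :=
  (hamiltonianGraph b).comap (LinearMap.prod LinearMap.id ((energy b n : ℂ) • LinearMap.id))

theorem mem_level {b : ℝ} {n : ℕ} {ψ : L2 2} :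
    ψ ∈ level b n ↔ (ψ, (energy b n : ℂ) • ψ) ∈ hamiltonianGraph b := Iff.rfl

theorem isClosed_level (b : ℝ) (n : ℕ) : IsClosed (level b n : Set (L2 2)) := by
  have h : Continuous fun ψ : L2 2 => (ψ, (energy b n : ℂ) • ψ) := by fun_prop
  exact (minimalGraph b).isClosed_topologicalClosure.preimage h

instance (b : ℝ) (n : ℕ) : CompleteSpace (level b n) :=
  (isClosed_level b n).completeSpace_coe

/-- The orthogonal projection `P_n` of `L²(ℝ²)` onto the `n`-th Landau level. -/
def levelProj (b : ℝ) (n : ℕ) : L2 2 →L[ℂ] L2 2 := (level b n).starProjection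

/-! ### Laguerre functions -/

/-- The binomial coefficient `α (α - 1) ⋯ (α - m + 1) / m!` of a real number `α`. -/
def binom (α : ℝ) (m : ℕ) : ℝ := (∏ i ∈ Finset.range m, (α - i)) / m.factorial

/-- The generalized Laguerre polynomial `L_n^{(α)}`. -/
def laguerre (n : ℕ) (α ξ : ℝ) : ℝ :=
  ∑ m ∈ Finset.range (n + 1), binom (n + α) (n - m) * ((-ξ) ^ m / m.factorial)

/-- The index set `{-n, -n + 1, …}`. -/
abbrev Index (n : ℕ) : Type := {k : ℤ // -(n : ℤ) ≤ k}

/-- The normalization `n! / (k + n)!`; here `k + n ≥ 0`. -/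
def factorialRatio (n : ℕ) (k : Index n) : ℝ :=
  (n.factorial : ℝ) / ((k.1 + n).toNat.factorial : ℝ)

/-- The Laguerre function `φ_{n,k}`. For `k < 0` the formula is meant for `x ≠ 0`, which determines
the function almost everywhere. -/
def laguerreFun (b : ℝ) (n : ℕ) (k : Index n) (x : Space 2) : ℂ :=
  (√(factorialRatio n k) : ℂ) * ((√(b / 2) : ℂ) * ((x 0 : ℂ) + Complex.I * (x 1 : ℂ))) ^ k.1 *
    (laguerre n (k.1 : ℝ) (b * ‖x‖ ^ 2 / 2) : ℂ) * (√(b / (2 * Real.pi)) : ℂ) *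
    (Real.exp (-(b * ‖x‖ ^ 2) / 4) : ℂ)

/-- The integrand `e^{-q⟨√(2ξ/b)⟩} e^{-ξ} ξ^k L_n^{(k)}(ξ)²`. -/
def eigenIntegrand (b q : ℝ) (n : ℕ) (k : Index n) (ξ : ℝ) : ℝ :=
  Real.exp (-q * bracket √(2 * ξ / b)) * Real.exp (-ξ) * ξ ^ k.1 * laguerre n (k.1 : ℝ) ξ ^ 2

/-- The number `λ_{n,k} = n!/(k+n)! ∫_0^∞ e^{-q⟨√(2ξ/b)⟩} e^{-ξ} ξ^k L_n^{(k)}(ξ)² dξ`. -/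
def eigenvalue (b q : ℝ) (n : ℕ) (k : Index n) : ℝ :=
  factorialRatio n k * ∫ ξ in Set.Ioi (0 : ℝ), eigenIntegrand b q n k ξ

end

end Landau

namespace Landau

noncomputable section

open scoped ComplexConjugate

/-! Write z for the complex coordinate. On a polynomial in z and its conjugate times the Gaussian
e^{-b|z|²/4}, the two magnetic momenta act as -i(R + D) and R - D, where R = ∂_z - (b/2)z̄ raises
and D = ∂_z̄ lowers. Hence the Hamiltonian is -(RD + DR), and DR = RD - b/2 makes R^n p an
eigenvector of energy E_n whenever Dp = 0. The recurrence for R^n z^N is that of the Laguerre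
polynomials, so R^n z^N is n! z^{N-n} L_n^{(N-n)}(b|z|²/2), and the φ_{n,k} are the normalized R^n
z^{n+k}.

Completeness. The R^n z^N span all polynomials, and polynomials times the Gaussian are dense, since
orthogonality to them kills a Fourier transform (`eq_zero_of_forall_inner_waveLp`). The closed
Hamiltonian is symmetric, so different levels are orthogonal; a vector of level n orthogonal to its
own waves is therefore orthogonal to all waves and vanishes (`eq_zero_of_mem_level`).
Self-adjointness is never needed.

Localization of P_n. Everything above commutes with magnetic translations. Evaluating R^n z^N at a
point is an inner product with the translate to that point of R^n z^n
(`inner_waveLp_raise_pow_X_zero_pow`). This extends to the whole level by density and gives a kernel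
whose modulus is a polynomial times a Gaussian in x - y.

Eigenvalues. A rotation by the unit complex number a multiplies φ_{n,k} by a^k and fixes the weight
e^{-q⟨x⟩}. So W_n is diagonal in this basis, with diagonal entries the moments of rate -q of
|φ_{n,k}|².

Uniform localization. Since e^{q⟨r⟩} = 1/λ, the weight e^{q|⟨x⟩-⟨r⟩|} is at most λe^{q⟨x⟩} +
λ⁻¹e^{-q⟨x⟩}. It suffices that the product of the moments of rates q and -q is bounded in k
(`exists_expMoment_mul_le`). For k = N large, the density in ξ = b‖x‖²/2 is, up to a factor
e^{|ξ-N|/√N}, at most a constant times a Gamma density. It therefore lives in a window of width √N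
around N, which is a window of bounded width in ‖x‖. Both moments are then comparable to
e^{±q⟨√(2N/b)⟩}, and these factors cancel. The key input is a bound on L_n^{(N)} of order N^{n/2} in
that window (`exists_abs_laguerre_le`). -/

/-! ### Functions that decay faster than every exponential -/

/-- `f` grows at most exponentially. -/
def ExpGrowth {d : ℕ} (f : Space d → ℂ) : Prop :=
  ∃ C a : ℝ, ∀ x, ‖f x‖ ≤ C * Real.exp (a * ‖x‖)

/-- `f` decays faster than every exponential. -/
def Decays {d : ℕ} (f : Space d → ℂ) : Prop :=
  ∀ β : ℝ, ∃ C : ℝ, ∀ x, ‖f x‖ ≤ C * Real.exp (-β * ‖x‖)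

section decay

variable {d : ℕ} {f g : Space d → ℂ}

theorem ExpGrowth.mul (hf : ExpGrowth f) (hg : ExpGrowth g) : ExpGrowth fun x => f x * g x := by
  obtain ⟨C, a, hC⟩ := hf
  obtain ⟨D, c, hD⟩ := hg
  refine ⟨C * D, a + c, fun x => ?_⟩
  rw [norm_mul, add_mul, Real.exp_add]
  calc ‖f x‖ * ‖g x‖ ≤ (C * Real.exp (a * ‖x‖)) * (D * Real.exp (c * ‖x‖)) :=
        mul_le_mul (hC x) (hD x) (norm_nonneg _) ((norm_nonneg _).trans (hC x))
    _ = _ := by ring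

theorem ExpGrowth.add (hf : ExpGrowth f) (hg : ExpGrowth g) : ExpGrowth fun x => f x + g x := by
  obtain ⟨C, a, hC⟩ := hf
  obtain ⟨D, c, hD⟩ := hg
  have hC0 : 0 ≤ C := by simpa using (norm_nonneg _).trans (hC 0)
  have hD0 : 0 ≤ D := by simpa using (norm_nonneg _).trans (hD 0)
  refine ⟨C + D, max a c, fun x => (norm_add_le _ _).trans ?_⟩
  rw [add_mul]
  refine add_le_add ((hC x).trans ?_) ((hD x).trans ?_)
  · gcongr; exact le_max_left _ _
  · gcongr; exact le_max_right _ _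

theorem expGrowth_const (c : ℂ) : ExpGrowth fun _ : Space d => c := ⟨‖c‖, 0, fun x => by simp⟩

theorem Decays.mul_expGrowth (hf : Decays f) (hg : ExpGrowth g) : Decays fun x => f x * g x := by
  obtain ⟨D, c, hD⟩ := hg
  intro β
  obtain ⟨C, hC⟩ := hf (β + c)
  refine ⟨C * D, fun x => ?_⟩
  rw [norm_mul, show -β * ‖x‖ = -(β + c) * ‖x‖ + c * ‖x‖ by ring, Real.exp_add]
  calc ‖f x‖ * ‖g x‖ ≤ (C * Real.exp (-(β + c) * ‖x‖)) * (D * Real.exp (c * ‖x‖)) :=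
        mul_le_mul (hC x) (hD x) (norm_nonneg _) ((norm_nonneg _).trans (hC x))
    _ = _ := by ring

theorem Decays.expGrowth (hf : Decays f) : ExpGrowth f := by
  obtain ⟨C, hC⟩ := hf 0
  exact ⟨C, 0, fun x => by simpa using hC x⟩

theorem Decays.mul (hf : Decays f) (hg : Decays g) : Decays fun x => f x * g x :=
  hf.mul_expGrowth hg.expGrowth

theorem Decays.const_mul (c : ℂ) (hf : Decays f) : Decays fun x => c * f x := by
  simpa only [mul_comm] using hf.mul_expGrowth (expGrowth_const c)

theorem Decays.add (hf : Decays f) (hg : Decays g) : Decays fun x => f x + g x := by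
  intro β
  obtain ⟨C, hC⟩ := hf β
  obtain ⟨D, hD⟩ := hg β
  exact ⟨C + D, fun x => (norm_add_le _ _).trans (by linarith [hC x, hD x])⟩

theorem Decays.sub (hf : Decays f) (hg : Decays g) : Decays fun x => f x - g x := by
  simpa [sub_eq_add_neg] using hf.add (hg.const_mul (-1))

theorem Decays.conj (hf : Decays f) : Decays fun x => conj (f x) := by
  simpa [Decays] using hf

theorem decays_of_hasCompactSupport (hf : Continuous f) (hc : HasCompactSupport f) :
    Decays f := by
  intro β
  have h2 : HasCompactSupport fun x => f x * (Real.exp (β * ‖x‖) : ℂ) := hc.mul_right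
  obtain ⟨C, hC⟩ := h2.exists_bound_of_continuous (by fun_prop)
  refine ⟨C, fun x => ?_⟩
  have h := hC x
  rw [norm_mul, Complex.norm_real, Real.norm_eq_abs, Real.abs_exp] at h
  rwa [neg_mul, Real.exp_neg, ← div_eq_mul_inv, le_div_iff₀ (Real.exp_pos _)]

theorem integrable_exp_neg_norm {a : ℝ} (ha : 0 < a) :
    Integrable fun x : Space d => Real.exp (-a * ‖x‖) := by
  have h1 : Integrable fun x : Space d => (1 + ‖x‖) ^ (-((d : ℝ) + 1)) :=
    integrable_one_add_norm (by simp)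
  obtain ⟨C, hC⟩ : ∃ C : ℝ, ∀ t : ℝ, 0 ≤ t → Real.exp (-a * t) * (1 + t) ^ (d + 1) ≤ C := by
    -- The constant comes from s^m/m! ≤ e^s at s = a(1 + t), m = d + 1.
    refine ⟨(d + 1).factorial * Real.exp a / a ^ (d + 1), fun t ht => ?_⟩
    have h2 := Real.pow_div_factorial_le_exp (a * (1 + t)) (by positivity) (d + 1)
    rw [div_le_iff₀ (by positivity), mul_pow] at h2
    rw [le_div_iff₀ (by positivity)]
    calc Real.exp (-a * t) * (1 + t) ^ (d + 1) * a ^ (d + 1)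
        ≤ Real.exp (-a * t) * (Real.exp (a * (1 + t)) * (d + 1).factorial) := by
          rw [mul_assoc, mul_comm ((1 + t) ^ (d + 1))]; gcongr
      _ = (d + 1).factorial * (Real.exp (-a * t) * Real.exp (a * (1 + t))) := by ring
      _ = _ := by rw [← Real.exp_add]; ring_nf
  refine (h1.const_mul C).mono' (by fun_prop) (Eventually.of_forall fun x => ?_)
  have hx : 0 < 1 + ‖x‖ := by positivity
  rw [Real.norm_eq_abs, Real.abs_exp, Real.rpow_neg hx.le, ← div_eq_mul_inv,
    show (d : ℝ) + 1 = ((d + 1 : ℕ) : ℝ) by push_cast; ring, Real.rpow_natCast,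
    le_div_iff₀ (by positivity)]
  exact hC _ (norm_nonneg _)

theorem Decays.integrable (hf : Decays f) (hm : AEStronglyMeasurable f volume) :
    Integrable f := by
  obtain ⟨C, hC⟩ := hf 1
  exact ((integrable_exp_neg_norm one_pos).const_mul C).mono' hm (Eventually.of_forall hC)

theorem Decays.memLp_two (hf : Decays f) (hm : AEStronglyMeasurable f volume) :
    MemLp f 2 volume := by
  rw [memLp_two_iff_integrable_sq_norm hm]
  have h := (hf.mul hf).integrable (hm.mul hm)
  simpa [sq] using h.norm

end decay

/-! ### The complex coordinate -/

/-- The complex coordinate `x₁ + i x₂`. -/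
def coord (x : Space 2) : ℂ := (x 0 : ℂ) + Complex.I * (x 1 : ℂ)

theorem coord_eq (x : Space 2) : coord x = Complex.orthonormalBasisOneI.repr.symm x := by
  rw [Complex.orthonormalBasisOneI_repr_symm_apply, coord, mul_comm]

theorem norm_coord (x : Space 2) : ‖coord x‖ = ‖x‖ := by
  rw [coord_eq, LinearIsometryEquiv.norm_map]

/-- The complex coordinate as a continuous linear map. -/
def coordCLM : Space 2 →L[ℝ] ℂ :=
  (Complex.orthonormalBasisOneI.repr.symm.toContinuousLinearEquiv : Space 2 →L[ℝ] ℂ)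

theorem coordCLM_apply (x : Space 2) : coordCLM x = coord x := (coord_eq x).symm

theorem hasFDerivAt_coord (x : Space 2) : HasFDerivAt coord coordCLM x :=
  (coordCLM.hasFDerivAt).congr_of_eventuallyEq (Eventually.of_forall fun y => coord_eq y)

theorem contDiff_coord : ContDiff ℝ ∞ coord := by
  rw [show coord = coordCLM from funext fun x => (coordCLM_apply x).symm]
  exact coordCLM.contDiff

theorem continuous_coord : Continuous coord := contDiff_coord.continuous

theorem coord_sub (x y : Space 2) : coord (x - y) = coord x - coord y := by
  simp [coord]; ring

theorem coord_mul_conj (x : Space 2) : coord x * conj (coord x) = ((‖x‖ ^ 2 : ℝ) : ℂ) := by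
  rw [Complex.mul_conj, Complex.normSq_eq_norm_sq, norm_coord]

theorem expGrowth_of_norm_le {f : Space 2 → ℂ} (hf : ∀ x, ‖f x‖ ≤ ‖x‖) : ExpGrowth f :=
  ⟨1, 1, fun x => (hf x).trans (by rw [one_mul, one_mul]; linarith [Real.add_one_le_exp ‖x‖])⟩

/-! ### Magnetically translated polynomials times the Gaussian -/

/-- Polynomials in `z` and its conjugate. -/
abbrev Poly : Type := MvPolynomial (Fin 2) ℂ

open MvPolynomial

/-- The value at `x` of the magnetic translate by `u` of the polynomial `p`. -/
def evalAt (u : ℂ) (p : Poly) (x : Space 2) : ℂ :=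
  eval ![coord x - u, conj (coord x) - conj u] p

/-- The magnetic translate by `u` of the Gaussian `e^{-b‖x‖²/4}`, up to a constant. -/
def gauss (b : ℝ) (u : ℂ) (x : Space 2) : ℂ :=
  Complex.exp (-(b / 4) * (coord x * conj (coord x)) + b / 2 * conj u * coord x)

/-- The magnetic translate by `u` of the polynomial `p` times the Gaussian. -/
def wave (b : ℝ) (u : ℂ) (p : Poly) (x : Space 2) : ℂ := evalAt u p x * gauss b u x

/-- The raising operator, acting on polynomials. -/
def raise (b : ℝ) : Poly →ₗ[ℂ] Poly :=
  (pderiv 0).toLinearMap - (b / 2 : ℂ) • LinearMap.mulLeft ℂ (X 1)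

/-- The lowering operator, acting on polynomials. -/
def lower : Poly →ₗ[ℂ] Poly := (pderiv 1).toLinearMap

theorem raise_apply (b : ℝ) (p : Poly) :
    raise b p = pderiv 0 p - (b / 2 : ℂ) • (X 1 * p) := rfl

theorem lower_apply (p : Poly) : lower p = pderiv 1 p := rfl

theorem pderiv_comm (p : Poly) : pderiv 1 (pderiv 0 p) = pderiv 0 (pderiv 1 p) := by
  -- The commutator of two derivations is a derivation, so it suffices to check it on the variables.
  have h : ⁅(pderiv 1 : Derivation ℂ Poly Poly), (pderiv 0 : Derivation ℂ Poly Poly)⁆ = 0 := by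
    apply MvPolynomial.derivation_ext
    intro i
    fin_cases i <;> simp [Derivation.commutator_apply, pderiv_X]
  have h2 := congrArg (fun D : Derivation ℂ Poly Poly => D p) h
  simpa [Derivation.commutator_apply, sub_eq_zero] using h2

/-- The canonical commutation relation; the constant is ∂_z̄ applied to the factor (b/2)z̄ in the
raising operator. -/
theorem lower_raise (b : ℝ) (p : Poly) :
    lower (raise b p) = raise b (lower p) - (b / 2 : ℂ) • p := by
  simp only [lower_apply, raise_apply, map_sub, Derivation.map_smul, Derivation.leibniz,
    pderiv_comm, pderiv_X_self, smul_eq_mul, smul_add, mul_one]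
  ring

theorem lower_raise_pow (b : ℝ) {p : Poly} (hp : lower p = 0) (n : ℕ) :
    lower ((raise b ^ (n + 1)) p) = (-((n + 1 : ℕ) * (b / 2)) : ℂ) • (raise b ^ n) p := by
  induction n with
  | zero => simp [lower_raise, hp]
  | succ n ih =>
    rw [pow_succ', Module.End.mul_apply, lower_raise, ih, map_smul, ← Module.End.mul_apply,
      ← pow_succ', ← sub_smul]
    congr 1
    push_cast
    ring

section wave

variable {b : ℝ} {u : ℂ}

theorem wave_add (p p' : Poly) : wave b u (p + p') = wave b u p + wave b u p' := by
  ext x; simp [wave, evalAt, add_mul]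

theorem wave_sub (p p' : Poly) : wave b u (p - p') = wave b u p - wave b u p' := by
  ext x; simp [wave, evalAt, sub_mul]

theorem wave_smul (c : ℂ) (p : Poly) : wave b u (c • p) = c • wave b u p := by
  ext x; simp [wave, evalAt, mul_assoc]

theorem evalAt_C (a : ℂ) : evalAt u (C a) = fun _ => a := by
  ext; simp [evalAt]

theorem evalAt_add (p q : Poly) : evalAt u (p + q) = fun x => evalAt u p x + evalAt u q x := by
  ext; simp [evalAt]

theorem evalAt_mul (p q : Poly) : evalAt u (p * q) = fun x => evalAt u p x * evalAt u q x := by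
  ext; simp [evalAt]

theorem evalAt_X_zero : evalAt u (X 0) = fun x => coord x - u := by
  ext; simp [evalAt]

theorem evalAt_X_one : evalAt u (X 1) = fun x => conj (coord x) - conj u := by
  ext; simp [evalAt]

theorem hasFDerivAt_evalAt (p : Poly) (x : Space 2) :
    HasFDerivAt (evalAt u p) (evalAt u (pderiv 0 p) x • coordCLM +
      evalAt u (pderiv 1 p) x • (Complex.conjCLE : ℂ →L[ℝ] ℂ).comp coordCLM) x := by
  induction p using MvPolynomial.induction_on with
  | C a =>
    rw [evalAt_C]
    refine (hasFDerivAt_const (𝕜 := ℝ) a x).congr_fderiv ?_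
    ext v
    simp [evalAt]
  | add p q hp hq =>
    rw [evalAt_add]
    refine (hp.add hq).congr_fderiv ?_
    ext v
    simp [evalAt]
    ring
  | mul_X p i hp =>
    fin_cases i
    · have h3 := hp.mul ((hasFDerivAt_coord x).sub_const u)
      simp only [Fin.zero_eta, Fin.isValue]
      rw [evalAt_mul, evalAt_X_zero]
      refine h3.congr_fderiv ?_
      ext v
      simp [evalAt, pderiv_X]
      ring
    · have h2 : HasFDerivAt (fun x => conj (coord x))
          ((Complex.conjCLE : ℂ →L[ℝ] ℂ).comp coordCLM) x :=
        (Complex.conjCLE : ℂ →L[ℝ] ℂ).hasFDerivAt.comp x (hasFDerivAt_coord x)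
      have h3 := hp.mul (h2.sub_const (conj u))
      simp only [Fin.mk_one, Fin.isValue]
      rw [evalAt_mul, evalAt_X_one]
      refine h3.congr_fderiv ?_
      ext v
      simp [evalAt, pderiv_X]
      ring

theorem hasFDerivAt_gauss (x : Space 2) :
    HasFDerivAt (gauss b u) (gauss b u x • ((-(b / 4 : ℂ)) • (coord x •
      (Complex.conjCLE : ℂ →L[ℝ] ℂ).comp coordCLM + conj (coord x) • coordCLM) +
      (b / 2 * conj u) • coordCLM)) x := by
  have h2 : HasFDerivAt (fun x => conj (coord x))
      ((Complex.conjCLE : ℂ →L[ℝ] ℂ).comp coordCLM) x :=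
    (Complex.conjCLE : ℂ →L[ℝ] ℂ).hasFDerivAt.comp x (hasFDerivAt_coord x)
  have h3 := (((hasFDerivAt_coord x).mul h2).const_mul (-(b / 4 : ℂ))).add
    ((hasFDerivAt_coord x).const_mul (b / 2 * conj u))
  exact h3.cexp

/-- The exponent has z-derivative -(b/4)z̄ + (b/2)ū = -(b/2)(z̄ - ū) + (b/4)z̄. The first part is
absorbed into `raise`, whose variables are centred at u. The other part, together with the
z̄-derivative -(b/4)z, is the last term; it is exactly what the vector potential cancels, so the
momenta take the same form for every u. -/
theorem fderiv_wave (p : Poly) (x v : Space 2) :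
    fderiv ℝ (wave b u p) x v = coord v * wave b u (raise b p) x +
      conj (coord v) * wave b u (lower p) x +
      b / 4 * (coord v * conj (coord x) - conj (coord v) * coord x) * wave b u p x := by
  have h := (hasFDerivAt_evalAt (u := u) p x).mul (hasFDerivAt_gauss (b := b) (u := u) x)
  have h2 : fderiv ℝ (wave b u p) x = _ := h.fderiv
  rw [h2]
  simp [wave, raise_apply, lower_apply, evalAt, coordCLM_apply]
  ring

theorem contDiff_wave (p : Poly) : ContDiff ℝ ∞ (wave b u p) := by
  have hc : ContDiff ℝ ∞ fun x : Space 2 => conj (coord x) :=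
    ContDiff.comp (Complex.conjCLE : ℂ →L[ℝ] ℂ).contDiff contDiff_coord
  have h1 : ContDiff ℝ ∞ (evalAt u p) := by
    induction p using MvPolynomial.induction_on with
    | C a => rw [evalAt_C]; exact contDiff_const
    | add p q hp hq => rw [evalAt_add]; exact hp.add hq
    | mul_X p i hp =>
      rw [evalAt_mul]
      fin_cases i
      · exact hp.mul (evalAt_X_zero (u := u) ▸ contDiff_coord.sub contDiff_const)
      · exact hp.mul (evalAt_X_one (u := u) ▸ hc.sub contDiff_const)
  have h2 : ContDiff ℝ ∞ (gauss b u) := by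
    have h3 : ContDiff ℝ ∞ fun x => -(b / 4 : ℂ) * (coord x * conj (coord x)) +
        b / 2 * conj u * coord x :=
      (contDiff_const.mul (contDiff_coord.mul hc)).add (contDiff_const.mul contDiff_coord)
    exact h3.cexp
  exact h1.mul h2

theorem continuous_wave (p : Poly) : Continuous (wave b u p) := (contDiff_wave p).continuous

theorem expGrowth_evalAt (p : Poly) : ExpGrowth (evalAt u p) := by
  induction p using MvPolynomial.induction_on with
  | C a => rw [evalAt_C]; exact expGrowth_const a
  | add p q hp hq => rw [evalAt_add]; exact hp.add hq
  | mul_X p i hp =>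
    rw [evalAt_mul]
    refine hp.mul ?_
    fin_cases i
    · simpa only [evalAt_X_zero, sub_eq_add_neg, Fin.zero_eta] using
        (expGrowth_of_norm_le fun x => (norm_coord x).le).add (expGrowth_const (-u))
    · simpa only [evalAt_X_one, sub_eq_add_neg, Fin.mk_one] using
        (expGrowth_of_norm_le (f := fun x => conj (coord x)) fun x => by
          simp [norm_coord]).add (expGrowth_const (-conj u))

theorem norm_gauss (x : Space 2) :
    ‖gauss b u x‖ = Real.exp (-(b / 4) * ‖x‖ ^ 2 + b / 2 * (conj u * coord x).re) := by
  have h : (-(b / 4) * (coord x * conj (coord x)) + b / 2 * conj u * coord x : ℂ) =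
      ((-(b / 4) * ‖x‖ ^ 2 : ℝ) : ℂ) + ((b / 2 : ℝ) : ℂ) * (conj u * coord x) := by
    rw [coord_mul_conj]; push_cast; ring
  rw [gauss, h, Complex.norm_exp, Complex.add_re, Complex.ofReal_re, Complex.re_ofReal_mul]

theorem decays_gauss (hb : 0 < b) : Decays (gauss b u) := by
  intro β
  -- The constant is left over from completing the square in (β + b‖u‖/2)‖x‖ - b‖x‖²/4.
  refine ⟨Real.exp ((β + b / 2 * ‖u‖) ^ 2 / b), fun x => ?_⟩
  rw [norm_gauss, ← Real.exp_add, Real.exp_le_exp]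
  have h1 : (conj u * coord x).re ≤ ‖u‖ * ‖x‖ := by
    refine (Complex.re_le_norm _).trans ?_
    rw [norm_mul, norm_coord, RCLike.norm_conj]
  have h2 : b / 2 * (conj u * coord x).re ≤ b / 2 * (‖u‖ * ‖x‖) := by gcongr
  have h3 : (β + b / 2 * ‖u‖) * ‖x‖ ≤ (β + b / 2 * ‖u‖) ^ 2 / b + b / 4 * ‖x‖ ^ 2 := by
    have h4 : (β + b / 2 * ‖u‖) ^ 2 / b + b / 4 * ‖x‖ ^ 2 - (β + b / 2 * ‖u‖) * ‖x‖ =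
        ((β + b / 2 * ‖u‖) - b / 2 * ‖x‖) ^ 2 / b := by field_simp; ring
    have h5 : 0 ≤ ((β + b / 2 * ‖u‖) - b / 2 * ‖x‖) ^ 2 / b := by positivity
    linarith
  nlinarith

theorem decays_wave (hb : 0 < b) (p : Poly) : Decays (wave b u p) := by
  simpa [wave, mul_comm] using! (decays_gauss hb (u := u)).mul_expGrowth (expGrowth_evalAt p)

theorem memLp_wave (hb : 0 < b) (p : Poly) : MemLp (wave b u p) 2 volume :=
  (decays_wave hb p).memLp_two (continuous_wave p).aestronglyMeasurable

theorem coord_single_zero : coord (EuclideanSpace.single 0 1) = 1 := by simp [coord]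

theorem coord_single_one : coord (EuclideanSpace.single 1 1) = Complex.I := by simp [coord]

theorem momentum_zero_wave (p : Poly) :
    momentum b 0 (wave b u p) = wave b u ((-Complex.I) • (raise b p + lower p)) := by
  ext x
  rw [momentum, fderiv_wave, coord_single_zero, wave_smul, wave_add]
  simp [vectorPotential, coord]
  ring_nf
  simp [Complex.I_sq]

theorem momentum_one_wave (p : Poly) :
    momentum b 1 (wave b u p) = wave b u (raise b p - lower p) := by
  ext x
  rw [momentum, fderiv_wave, coord_single_one, wave_sub]
  simp [vectorPotential, coord]
  ring_nf
  simp [Complex.I_sq]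
  ring

/-- In ½((-i(R + D))² + (R - D)²) the squares of R and D cancel and only the mixed terms remain. -/
theorem landauExpr_wave (p : Poly) :
    landauExpr b (wave b u p) = wave b u (-(raise b (lower p) + lower (raise b p))) := by
  ext x
  rw [landauExpr, Fin.sum_univ_two, momentum_zero_wave, momentum_zero_wave, momentum_one_wave,
    momentum_one_wave, show ∀ f g : Space 2 → ℂ, f x + g x = (f + g) x from fun _ _ => rfl,
    ← wave_add, ← smul_eq_mul, ← Pi.smul_apply (1 / 2 : ℂ), ← wave_smul]
  congr 2
  simp only [map_add, map_sub, map_smul, ← smul_add, smul_smul]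
  rw [show -Complex.I * -Complex.I = -1 by simp]
  module

/-- By `lower_raise_pow`, the term RD contributes n·b/2 and DR contributes (n + 1)·b/2, after the
sign; together they give E_n. -/
theorem landauExpr_wave_raise_pow {p : Poly} (hp : lower p = 0) (n : ℕ) :
    landauExpr b (wave b u ((raise b ^ n) p)) =
      (energy b n : ℂ) • wave b u ((raise b ^ n) p) := by
  rw [landauExpr_wave, ← wave_smul]
  congr 1
  have h1 := lower_raise_pow b hp n
  rw [pow_succ', Module.End.mul_apply] at h1
  rw [h1, energy]
  cases n with
  | zero => simp [hp]
  | succ n =>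
    rw [lower_raise_pow b hp n, map_smul, ← Module.End.mul_apply, ← pow_succ', ← add_smul,
      ← neg_smul]
    congr 1
    push_cast
    ring

end wave

/-! ### Symmetry of the Landau Hamiltonian -/

theorem inner_eq_integral {d : ℕ} {F G : L2 d} {f g : Space d → ℂ}
    (hf : (F : Space d → ℂ) =ᵐ[volume] f) (hg : (G : Space d → ℂ) =ᵐ[volume] g) :
    ⟪F, G⟫_ℂ = ∫ x, conj (f x) * g x := by
  rw [L2.inner_def]
  refine integral_congr_ae ?_
  filter_upwards [hf, hg] with x h1 h2
  rw [RCLike.inner_apply, h1, h2, mul_comm]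

theorem expGrowth_vectorPotential (b : ℝ) (j : Fin 2) :
    ExpGrowth fun x => ((b * vectorPotential x j : ℝ) : ℂ) := by
  have h : ExpGrowth fun x => ((vectorPotential x j : ℝ) : ℂ) := by
    refine expGrowth_of_norm_le fun x => ?_
    have h0 := EuclideanSpace.norm_eq x
    have h1 : ∀ i, |x i| ≤ ‖x‖ := fun i => by simpa using PiLp.norm_apply_le x i
    rw [Complex.norm_real, Real.norm_eq_abs]
    fin_cases j
    · have := h1 1
      simp only [vectorPotential, abs_le, Fin.zero_eta, Matrix.cons_val_zero] at *
      constructor <;> linarith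
    · have := h1 0
      simp only [vectorPotential, abs_le, Fin.mk_one, Matrix.cons_val_one,
        Matrix.cons_val_fin_one] at *
      constructor <;> linarith
  simpa using (expGrowth_const (b : ℂ)).mul h

section symmetry

variable {b : ℝ} {f g : Space 2 → ℂ}

theorem Decays.fderiv_single (hf : Decays f) {j : Fin 2} (hf' : Decays (momentum b j f)) :
    Decays fun x => fderiv ℝ f x (EuclideanSpace.single j 1) := by
  have h := (hf'.add (hf.mul_expGrowth (expGrowth_vectorPotential b j))).const_mul Complex.I
  convert h using 2 with x
  rw [momentum]
  ring_nf
  simp [Complex.I_sq]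

theorem continuous_fderiv_single (hf : ContDiff ℝ ∞ f) (v : Space 2) :
    Continuous fun x => fderiv ℝ f x v :=
  (hf.continuous_fderiv (by simp)).clm_apply continuous_const

theorem fderiv_conj_apply (hf : ContDiff ℝ ∞ f) (x v : Space 2) :
    fderiv ℝ (fun x => conj (f x)) x v = conj (fderiv ℝ f x v) := by
  have h := ((Complex.conjCLE : ℂ →L[ℝ] ℂ).hasFDerivAt.comp x
    ((hf.differentiable (by simp)) x).hasFDerivAt).fderiv
  have h2 : fderiv ℝ (fun x => conj (f x)) x = _ := h
  rw [h2]
  simp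

/-- Integration by parts. Rapid decay replaces compact support so that the identity applies to the
waves as well as to the core. -/
theorem integral_conj_mul_momentum {j : Fin 2} (hf : ContDiff ℝ ∞ f) (hg : ContDiff ℝ ∞ g)
    (hf0 : Decays f) (hg0 : Decays g) (hf1 : Decays (momentum b j f))
    (hg1 : Decays (momentum b j g)) :
    ∫ x, conj (f x) * momentum b j g x = ∫ x, conj (momentum b j f x) * g x := by
  set v : Space 2 := EuclideanSpace.single j 1
  have hcf : Continuous fun x => conj (f x) := Complex.continuous_conj.comp hf.continuous
  have hcf' := continuous_fderiv_single hf v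
  have hcg' := continuous_fderiv_single hg v
  have hcc : Continuous fun x => conj (fderiv ℝ f x v) := Complex.continuous_conj.comp hcf'
  have hA : Continuous fun x => ((b * vectorPotential x j : ℝ) : ℂ) :=
    Complex.continuous_ofReal.comp (continuous_const.mul (contDiff_vectorPotential j).continuous)
  have i1 : Integrable fun x => conj (fderiv ℝ f x v) * g x :=
    ((hf0.fderiv_single hf1).conj.mul hg0).integrable
      (hcc.mul hg.continuous).aestronglyMeasurable
  have i2 : Integrable fun x => conj (f x) * fderiv ℝ g x v :=
    (hf0.conj.mul (hg0.fderiv_single hg1)).integrable (hcf.mul hcg').aestronglyMeasurable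
  have i3 : Integrable fun x => conj (f x) * g x :=
    (hf0.conj.mul hg0).integrable (hcf.mul hg.continuous).aestronglyMeasurable
  have i4 : Integrable fun x => conj (f x) * g x * ((b * vectorPotential x j : ℝ) : ℂ) :=
    ((hf0.conj.mul hg0).mul_expGrowth (expGrowth_vectorPotential b j)).integrable
      ((hcf.mul hg.continuous).mul hA).aestronglyMeasurable
  have key := integral_mul_fderiv_eq_neg_fderiv_mul_of_integrable (μ := volume)
    (f := fun x => conj (f x)) (g := g) (v := v)
    (by simpa only [fderiv_conj_apply hf] using i1) i2 i3
    (fun x _ => by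
      exact (Complex.conjCLE : ℂ →L[ℝ] ℂ).differentiableAt.comp x
        ((hf.differentiable (by simp)) x))
    (fun x _ => (hg.differentiable (by simp)) x)
  simp only [fderiv_conj_apply hf] at key
  have e1 : ∀ x, conj (f x) * momentum b j g x = -Complex.I * (conj (f x) * fderiv ℝ g x v) -
      conj (f x) * g x * ((b * vectorPotential x j : ℝ) : ℂ) := fun x => by
    rw [momentum]; ring
  have e2 : ∀ x, conj (momentum b j f x) * g x = Complex.I * (conj (fderiv ℝ f x v) * g x) -
      conj (f x) * g x * ((b * vectorPotential x j : ℝ) : ℂ) := fun x => by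
    simp only [momentum, map_sub, map_mul, map_neg, Complex.conj_I, Complex.conj_ofReal]; ring
  simp only [e1, e2]
  rw [integral_sub (i2.const_mul _) i4, integral_sub (i1.const_mul _) i4,
    integral_const_mul, integral_const_mul, key]
  ring

theorem hasCompactSupport_momentum (hfc : HasCompactSupport f) (j : Fin 2) :
    HasCompactSupport (momentum b j f) :=
  ((hfc.fderiv_apply ℝ (EuclideanSpace.single j 1)).mul_left).sub hfc.mul_left

theorem decays_momentum_of_hasCompactSupport (hf : ContDiff ℝ ∞ f) (hfc : HasCompactSupport f)
    (j : Fin 2) : Decays (momentum b j f) :=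
  decays_of_hasCompactSupport (contDiff_momentum b j hf).continuous
    (hasCompactSupport_momentum hfc j)

theorem integral_conj_mul_landauExpr (hf : ContDiff ℝ ∞ f) (hg : ContDiff ℝ ∞ g)
    (hfc : HasCompactSupport f) (hgc : HasCompactSupport g) :
    ∫ x, conj (f x) * landauExpr b g x = ∫ x, conj (landauExpr b f x) * g x := by
  have key : ∀ j, ∫ x, conj (f x) * momentum b j (momentum b j g) x =
      ∫ x, conj (momentum b j (momentum b j f) x) * g x := fun j => by
    have hf1 := contDiff_momentum b j hf
    have hg1 := contDiff_momentum b j hg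
    have hfc1 := hasCompactSupport_momentum (b := b) hfc j
    have hgc1 := hasCompactSupport_momentum (b := b) hgc j
    have d0 := decays_of_hasCompactSupport hf.continuous hfc
    have d1 := decays_of_hasCompactSupport hg.continuous hgc
    have d2 := decays_momentum_of_hasCompactSupport (b := b) hf hfc j
    have d3 := decays_momentum_of_hasCompactSupport (b := b) hg hgc j
    rw [integral_conj_mul_momentum hf hg1 d0 d3 d2
        (decays_momentum_of_hasCompactSupport hg1 hgc1 j),
      integral_conj_mul_momentum hf1 hg d2 d1
        (decays_momentum_of_hasCompactSupport hf1 hfc1 j) d3]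
  have i1 : ∀ j, Integrable fun x => conj (f x) * momentum b j (momentum b j g) x := fun j =>
    ((decays_of_hasCompactSupport hf.continuous hfc).conj.mul
      (decays_momentum_of_hasCompactSupport (contDiff_momentum b j hg)
        (hasCompactSupport_momentum hgc j) j)).integrable
      ((Complex.continuous_conj.comp hf.continuous).mul
        (contDiff_momentum b j (contDiff_momentum b j hg)).continuous).aestronglyMeasurable
  have i2 : ∀ j, Integrable fun x => conj (momentum b j (momentum b j f) x) * g x := fun j =>
    ((decays_momentum_of_hasCompactSupport (contDiff_momentum b j hf)
        (hasCompactSupport_momentum hfc j) j).conj.mul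
      (decays_of_hasCompactSupport hg.continuous hgc)).integrable
      ((Complex.continuous_conj.comp (contDiff_momentum b j
        (contDiff_momentum b j hf)).continuous).mul hg.continuous).aestronglyMeasurable
  have e1 : ∀ x, conj (f x) * landauExpr b g x =
      (1 / 2 : ℂ) * ∑ j : Fin 2, conj (f x) * momentum b j (momentum b j g) x := fun x => by
    rw [landauExpr, ← Finset.mul_sum]; ring
  have e2 : ∀ x, conj (landauExpr b f x) * g x =
      (1 / 2 : ℂ) * ∑ j : Fin 2, conj (momentum b j (momentum b j f) x) * g x := fun x => by
    rw [landauExpr, ← Finset.sum_mul, map_mul, map_sum, Fin.sum_univ_two, map_div₀,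
      map_one, map_ofNat]
    ring
  simp only [e1, e2]
  rw [integral_const_mul, integral_const_mul, integral_finsetSum _ fun j _ => i1 j,
    integral_finsetSum _ fun j _ => i2 j]
  simp only [key]

/-- The identity holds on the core and is closed in each of the two arguments, so it passes to the
closure one argument at a time. -/
theorem inner_hamiltonianGraph {p p' : L2 2 × L2 2} (hp : p ∈ hamiltonianGraph b)
    (hp' : p' ∈ hamiltonianGraph b) : ⟪p.1, p'.2⟫_ℂ = ⟪p.2, p'.1⟫_ℂ := by
  have h0 : ∀ p ∈ minimalGraph b, ∀ p' ∈ minimalGraph b, ⟪p.1, p'.2⟫_ℂ = ⟪p.2, p'.1⟫_ℂ := by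
    rintro p ⟨f, hf, hfc, h1, h2⟩ p' ⟨g, hg, hgc, h3, h4⟩
    rw [inner_eq_integral h1 h4, inner_eq_integral h2 h3,
      integral_conj_mul_landauExpr hf hg hfc hgc]
  have h1 : ∀ p ∈ minimalGraph b, ⟪p.1, p'.2⟫_ℂ = ⟪p.2, p'.1⟫_ℂ := fun p hpm => by
    have hcl : IsClosed {q : L2 2 × L2 2 | ⟪p.1, q.2⟫_ℂ = ⟪p.2, q.1⟫_ℂ} :=
      isClosed_eq (by fun_prop) (by fun_prop)
    exact closure_minimal (fun q hq => h0 p hpm q hq) hcl hp'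
  have hcl : IsClosed {q : L2 2 × L2 2 | ⟪q.1, p'.2⟫_ℂ = ⟪q.2, p'.1⟫_ℂ} :=
    isClosed_eq (by fun_prop) (by fun_prop)
  exact closure_minimal h1 hcl hp

theorem inner_eq_zero_of_mem_level (hb : 0 < b) {n m : ℕ} (hnm : n ≠ m) {ψ χ : L2 2}
    (hψ : ψ ∈ level b n) (hχ : χ ∈ level b m) : ⟪ψ, χ⟫_ℂ = 0 := by
  have h := inner_hamiltonianGraph (mem_level.1 hψ) (mem_level.1 hχ)
  simp only [inner_smul_right, inner_smul_left, Complex.conj_ofReal] at h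
  have h2 : ((energy b m - energy b n : ℝ) : ℂ) * ⟪ψ, χ⟫_ℂ = 0 := by
    push_cast
    linear_combination h
  rcases mul_eq_zero.1 h2 with h3 | h3
  · exfalso
    rw [Complex.ofReal_eq_zero, energy, energy] at h3
    have h4 : b * ((m : ℝ) - n) = 0 := by linarith
    rcases mul_eq_zero.1 h4 with h5 | h5
    · exact hb.ne' h5
    · exact hnm (by exact_mod_cast (sub_eq_zero.1 h5).symm)
  · exact h3

/-! ### Rapidly decaying functions are in the domain -/

theorem momentum_dilate_mul {G : Space 2 → ℂ} (hG : ContDiff ℝ ∞ G) (hf : ContDiff ℝ ∞ f)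
    (ε : ℝ) (j : Fin 2) :
    momentum b j (fun x => G (ε • x) * f x) =
      (fun x => G (ε • x) * momentum b j f x) + (-Complex.I * ε : ℂ) •
        fun x => fderiv ℝ G (ε • x) (EuclideanSpace.single j 1) * f x := by
  ext x
  have h1 : HasFDerivAt (fun x : Space 2 => G (ε • x))
      ((fderiv ℝ G (ε • x)).comp (ε • ContinuousLinearMap.id ℝ (Space 2))) x :=
    ((hG.differentiable (by simp)) (ε • x)).hasFDerivAt.comp x
      ((hasFDerivAt_id x).const_smul ε)
  have h2 := (h1.mul ((hf.differentiable (by simp)) x).hasFDerivAt).fderiv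
  have h3 : fderiv ℝ (fun x => G (ε • x) * f x) x = _ := h2
  rw [momentum, h3]
  simp [momentum]
  ring

theorem landauExpr_dilate_mul {G : Space 2 → ℂ} (hG : ContDiff ℝ ∞ G) (hf : ContDiff ℝ ∞ f)
    (ε : ℝ) (x : Space 2) :
    landauExpr b (fun x => G (ε • x) * f x) x = G (ε • x) * landauExpr b f x +
      ε * ∑ j : Fin 2, (-Complex.I * fderiv ℝ G (ε • x) (EuclideanSpace.single j 1) *
        momentum b j f x - ε / 2 * fderiv ℝ (fun y => fderiv ℝ G y (EuclideanSpace.single j 1))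
          (ε • x) (EuclideanSpace.single j 1) * f x) := by
  have hG' : ∀ j : Fin 2, ContDiff ℝ ∞ fun y => fderiv ℝ G y (EuclideanSpace.single j 1) :=
    fun j => (hG.fderiv_right (by simp)).clm_apply contDiff_const
  have hdil : ∀ {K : Space 2 → ℂ}, ContDiff ℝ ∞ K → ContDiff ℝ ∞ fun x : Space 2 => K (ε • x) :=
    fun hK => hK.comp (contDiff_const_smul ε)
  have hdd : ∀ j : Fin 2, ContDiff ℝ ∞ ((-Complex.I * ε : ℂ) •
      fun x => fderiv ℝ G (ε • x) (EuclideanSpace.single j 1) * f x) := fun j =>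
    contDiff_const.mul ((hdil (hG' j)).mul hf)
  have h : ∀ j, momentum b j (momentum b j fun x => G (ε • x) * f x) x =
      G (ε • x) * momentum b j (momentum b j f) x +
      2 * ε * (-Complex.I * fderiv ℝ G (ε • x) (EuclideanSpace.single j 1) *
        momentum b j f x - ε / 2 * fderiv ℝ (fun y => fderiv ℝ G y (EuclideanSpace.single j 1))
          (ε • x) (EuclideanSpace.single j 1) * f x) := fun j => by
    rw [momentum_dilate_mul hG hf, momentum_add b j ((hdil hG).mul (contDiff_momentum b j hf))
      (hdd j), momentum_smul b j _ ((hdil (hG' j)).mul hf),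
      momentum_dilate_mul hG (contDiff_momentum b j hf), momentum_dilate_mul (hG' j) hf]
    simp only [Pi.add_apply, Pi.smul_apply, smul_eq_mul]
    ring_nf
    simp only [Complex.I_sq]
    ring
  simp only [landauExpr, h, Fin.sum_univ_two]
  ring

/-- Cut f off by G(εx). The commutators with the momenta carry a factor ε, and |G(εx) - 1| ≤ ε‖x‖.
Both the cut-off function and its image under the Landau expression thus differ from their limits by
at most ε times one fixed square integrable function. -/
theorem mem_hamiltonianGraph_of_decays (hf : ContDiff ℝ ∞ f) (hf0 : Decays f)
    (hf1 : ∀ j, Decays (momentum b j f)) (hf2 : Decays (landauExpr b f))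
    {ψ χ : L2 2} (hψ : (ψ : Space 2 → ℂ) =ᵐ[volume] f)
    (hχ : (χ : Space 2 → ℂ) =ᵐ[volume] landauExpr b f) : (ψ, χ) ∈ hamiltonianGraph b := by
  let bump : ContDiffBump (0 : Space 2) := ⟨1, 2, one_pos, one_lt_two⟩
  let G : Space 2 → ℂ := fun x => (bump x : ℂ)
  have hG : ContDiff ℝ ∞ G := Complex.ofRealCLM.contDiff.comp bump.contDiff
  have hGc : HasCompactSupport G := bump.hasCompactSupport.comp_left Complex.ofReal_zero
  -- Where ‖εx‖ ≤ 1 the bump equals 1; elsewhere its values in [0, 1] make the difference at most 1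
  -- ≤ ‖εx‖.
  have hG1 : ∀ (ε : ℝ) (x : Space 2), 0 ≤ ε → ‖G (ε • x) - 1‖ ≤ ε * ‖x‖ := fun ε x hε => by
    have hn : ‖ε • x‖ = ε * ‖x‖ := by rw [norm_smul, Real.norm_eq_abs, abs_of_nonneg hε]
    rw [← hn]
    simp only [G]
    rw [← Complex.ofReal_one, ← Complex.ofReal_sub, Complex.norm_real, Real.norm_eq_abs]
    rcases le_total ‖ε • x‖ 1 with h | h
    · rw [bump.one_of_mem_closedBall (by simpa [bump] using h)]
      simp
    · have h0 := bump.nonneg (x := ε • x)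
      have h1 := bump.le_one (x := ε • x)
      rw [abs_le]
      constructor <;> linarith
  have hG' : ∀ j : Fin 2, ContDiff ℝ ∞ fun y => fderiv ℝ G y (EuclideanSpace.single j 1) :=
    fun j => (hG.fderiv_right (by simp)).clm_apply contDiff_const
  have hGc' : ∀ j : Fin 2,
      HasCompactSupport fun y => fderiv ℝ G y (EuclideanSpace.single j (1 : ℝ)) :=
    fun j => hGc.fderiv_apply ℝ _
  choose C1 hC1 using fun j => (hGc' j).exists_bound_of_continuous (hG' j).continuous
  choose C2 hC2 using fun j : Fin 2 =>
    ((hGc' j).fderiv_apply ℝ (EuclideanSpace.single j (1 : ℝ))).exists_bound_of_continuous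
      (continuous_fderiv_single (hG' j) _)
  obtain ⟨K0, hK0⟩ := hf0 1
  choose K1 hK1 using fun j => hf1 j 1
  have hxg : ExpGrowth fun x : Space 2 => ((‖x‖ : ℝ) : ℂ) :=
    expGrowth_of_norm_le fun x => by simp
  obtain ⟨K2, hK2⟩ := hf0.mul_expGrowth hxg 1
  obtain ⟨K3, hK3⟩ := hf2.mul_expGrowth hxg 1
  set w : Space 2 → ℝ := fun x => Real.exp (-1 * ‖x‖)
  obtain ⟨K, hKf, hKH⟩ : ∃ K : ℝ, (∀ ε : ℝ, 0 ≤ ε → ε ≤ 1 → ∀ x,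
      ‖G (ε • x) * f x - f x‖ ≤ ε * (K * w x)) ∧ (∀ ε : ℝ, 0 ≤ ε → ε ≤ 1 → ∀ x,
      ‖landauExpr b (fun x => G (ε • x) * f x) x - landauExpr b f x‖ ≤ ε * (K * w x)) := by
    refine ⟨max K2 (K3 + ∑ j, (C1 j * K1 j + C2 j * K0)), fun ε h0 h1 x => ?_,
      fun ε h0 h1 x => ?_⟩
    · have h := hK2 x
      simp only [norm_mul, Complex.norm_real, norm_norm] at h
      rw [← sub_one_mul, norm_mul]
      calc ‖G (ε • x) - 1‖ * ‖f x‖ ≤ ε * ‖x‖ * ‖f x‖ := by gcongr; exact hG1 ε x h0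
        _ = ε * (‖f x‖ * ‖x‖) := by ring
        _ ≤ ε * (K2 * w x) := by gcongr
        _ ≤ _ := by gcongr; exact le_max_left _ _
    · have h := hK3 x
      simp only [norm_mul, Complex.norm_real, norm_norm] at h
      rw [landauExpr_dilate_mul hG hf, add_sub_right_comm, ← sub_one_mul]
      have hw : 0 ≤ w x := (Real.exp_pos _).le
      have hj : ∀ j, ‖-Complex.I * fderiv ℝ G (ε • x) (EuclideanSpace.single j 1) *
          momentum b j f x - ε / 2 * fderiv ℝ (fun y => fderiv ℝ G y
          (EuclideanSpace.single j 1)) (ε • x) (EuclideanSpace.single j 1) * f x‖ ≤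
          (C1 j * K1 j + C2 j * K0) * w x := fun j => by
        refine (norm_sub_le _ _).trans ?_
        rw [add_mul]
        have hC1j := hC1 j (ε • x)
        have hC2j := hC2 j (ε • x)
        have hc1 : 0 ≤ C1 j := (norm_nonneg _).trans hC1j
        have hc2 : 0 ≤ C2 j := (norm_nonneg _).trans hC2j
        refine add_le_add ?_ ?_
        · rw [norm_mul, norm_mul, norm_neg, Complex.norm_I, one_mul, mul_assoc]
          exact mul_le_mul hC1j (hK1 j x) (norm_nonneg _) hc1
        · rw [norm_mul, norm_mul, mul_assoc]
          have h2 : ‖(ε / 2 : ℂ)‖ ≤ 1 := by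
            rw [norm_div, Complex.norm_real, Real.norm_eq_abs, abs_of_nonneg h0]
            norm_num
            linarith
          calc _ ≤ 1 * _ := mul_le_mul_of_nonneg_right h2 (by positivity)
            _ ≤ C2 j * K0 * w x := by
              rw [one_mul, mul_assoc]
              exact mul_le_mul hC2j (hK0 x) (norm_nonneg _) hc2
      calc _ ≤ ‖G (ε • x) - 1‖ * ‖landauExpr b f x‖ + ε * ∑ j, (C1 j * K1 j + C2 j * K0) * w x := by
            refine (norm_add_le _ _).trans (add_le_add (norm_mul _ _).le ?_)
            rw [norm_mul, Complex.norm_real, Real.norm_eq_abs, abs_of_nonneg h0]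
            gcongr
            exact (norm_sum_le _ _).trans (Finset.sum_le_sum fun j _ => hj j)
        _ ≤ ε * ‖x‖ * ‖landauExpr b f x‖ + ε * ∑ j, (C1 j * K1 j + C2 j * K0) * w x := by
            gcongr; exact hG1 ε x h0
        _ = ε * (‖landauExpr b f x‖ * ‖x‖ + (∑ j, (C1 j * K1 j + C2 j * K0)) * w x) := by
            rw [Finset.sum_mul]; ring
        _ ≤ ε * (K3 * w x + (∑ j, (C1 j * K1 j + C2 j * K0)) * w x) := by gcongr
        _ = ε * ((K3 + ∑ j, (C1 j * K1 j + C2 j * K0)) * w x) := by ring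
        _ ≤ _ := by gcongr; exact le_max_right _ _
  have hwc : Continuous fun x => ((K * w x : ℝ) : ℂ) := by fun_prop
  have hwL : MemLp (fun x => ((K * w x : ℝ) : ℂ)) 2 volume := by
    rw [memLp_two_iff_integrable_sq_norm hwc.aestronglyMeasurable]
    refine ((integrable_exp_neg_norm (d := 2) two_pos).const_mul (K ^ 2)).congr
      (Eventually.of_forall fun x => ?_)
    simp only [w, Complex.norm_real, Real.norm_eq_abs, sq_abs, mul_pow, ← Real.exp_nat_mul]
    congr 2
    push_cast; ring
  have hsm : ∀ ε : ℝ, ContDiff ℝ ∞ fun x => G (ε • x) * f x := fun ε =>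
    (hG.comp (contDiff_const_smul ε)).mul hf
  have hcs : ∀ ε : ℝ, ε ≠ 0 → HasCompactSupport fun x => G (ε • x) * f x := fun ε hε =>
    (hGc.comp_smul hε).mul_right
  have hH : ∀ {g : Space 2 → ℂ}, ContDiff ℝ ∞ g → Continuous (landauExpr b g) := fun hg =>
    continuous_const.mul (continuous_finsetSum _ fun j _ =>
      (contDiff_momentum b j (contDiff_momentum b j hg)).continuous)
  have hHc : ∀ {g : Space 2 → ℂ}, HasCompactSupport g → HasCompactSupport (landauExpr b g) :=
    fun {g} hg => by
      have h : landauExpr b g = fun x => (1 / 2 : ℂ) *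
          (momentum b 0 (momentum b 0 g) x + momentum b 1 (momentum b 1 g) x) := by
        ext x; rw [landauExpr, Fin.sum_univ_two]
      rw [h]
      exact HasCompactSupport.mul_left
        ((hasCompactSupport_momentum (hasCompactSupport_momentum hg 0) 0).add
          (hasCompactSupport_momentum (hasCompactSupport_momentum hg 1) 1))
  let ε : ℕ → ℝ := fun k => 1 / ((k : ℝ) + 1)
  have hε0 : ∀ k, 0 < ε k := fun k => by positivity
  have hε1 : ∀ k, ε k ≤ 1 := fun k => by
    simp only [ε]; rw [div_le_one (by positivity)]; linarith [k.cast_nonneg (α := ℝ)]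
  have m1 : ∀ k, MemLp (fun x => G (ε k • x) * f x) 2 volume := fun k =>
    (hsm _).continuous.memLp_of_hasCompactSupport (hcs _ (hε0 k).ne')
  have m2 : ∀ k, MemLp (landauExpr b fun x => G (ε k • x) * f x) 2 volume := fun k =>
    (hH (hsm _)).memLp_of_hasCompactSupport (hHc (hcs _ (hε0 k).ne'))
  have hlim : Tendsto (fun k => ε k * ‖hwL.toLp‖) atTop (𝓝 0) := by
    rw [← zero_mul ‖hwL.toLp‖]
    exact (tendsto_one_div_add_atTop_nhds_zero_nat (𝕜 := ℝ)).mul_const ‖hwL.toLp‖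
  have hK0' : ∀ k x, ε k * (K * w x) ≤ ε k * ‖((K * w x : ℝ) : ℂ)‖ := fun k x => by
    rw [Complex.norm_real]
    exact mul_le_mul_of_nonneg_left (Real.le_norm_self _) (hε0 k).le
  refine mem_closure_of_tendsto (f := fun k => ((m1 k).toLp, (m2 k).toLp)) (b := atTop)
    (Tendsto.prodMk_nhds ?_ ?_) (Eventually.of_forall fun k => ?_)
  · rw [tendsto_iff_norm_sub_tendsto_zero]
    refine squeeze_zero (fun _ => norm_nonneg _) (fun k => ?_) hlim
    refine Lp.norm_le_mul_norm_of_ae_le_mul ?_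
    filter_upwards [Lp.coeFn_sub (m1 k).toLp ψ, (m1 k).coeFn_toLp, hψ, hwL.coeFn_toLp]
      with x h1 h2 h3 h4
    rw [h1, Pi.sub_apply, h2, h3, h4]
    exact (hKf _ (hε0 k).le (hε1 k) x).trans (hK0' k x)
  · rw [tendsto_iff_norm_sub_tendsto_zero]
    refine squeeze_zero (fun _ => norm_nonneg _) (fun k => ?_) hlim
    refine Lp.norm_le_mul_norm_of_ae_le_mul ?_
    filter_upwards [Lp.coeFn_sub (m2 k).toLp χ, (m2 k).coeFn_toLp, hχ, hwL.coeFn_toLp]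
      with x h1 h2 h3 h4
    rw [h1, Pi.sub_apply, h2, h3, h4]
    exact (hKH _ (hε0 k).le (hε1 k) x).trans (hK0' k x)
  · exact ⟨_, hsm _, hcs _ (hε0 k).ne', (m1 k).coeFn_toLp, (m2 k).coeFn_toLp⟩

end symmetry

/-! ### Waves as elements of the Landau levels -/

section levels

variable {b : ℝ} (hb : 0 < b) {u v : ℂ}

/-- The wave with parameters `u` and `p` as an element of `L²(ℝ²)`. -/
def waveLp (u : ℂ) (p : Poly) : L2 2 := (memLp_wave hb p (u := u)).toLp

theorem coeFn_waveLp (p : Poly) : (waveLp hb u p : Space 2 → ℂ) =ᵐ[volume] wave b u p :=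
  MemLp.coeFn_toLp _

theorem decays_momentum_wave (hb : 0 < b) (p : Poly) (j : Fin 2) :
    Decays (momentum b j (wave b u p)) := by
  fin_cases j
  · simpa only [Fin.zero_eta, momentum_zero_wave] using decays_wave hb _
  · simpa only [Fin.mk_one, momentum_one_wave] using decays_wave hb _

theorem waveLp_mem_level {p : Poly} (hp : lower p = 0) (n : ℕ) :
    waveLp hb u ((raise b ^ n) p) ∈ level b n := by
  rw [mem_level]
  refine mem_hamiltonianGraph_of_decays (contDiff_wave _) (decays_wave hb _)
    (decays_momentum_wave hb _) ?_ (coeFn_waveLp hb _) ?_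
  · rw [landauExpr_wave]; exact decays_wave hb _
  · rw [landauExpr_wave_raise_pow hp]
    exact (Lp.coeFn_smul _ _).trans ((coeFn_waveLp hb _).const_smul _)

theorem inner_waveLp (p q : Poly) :
    ⟪waveLp hb u p, waveLp hb v q⟫_ℂ = ∫ x, conj (wave b u p x) * wave b v q x :=
  inner_eq_integral (coeFn_waveLp hb p) (coeFn_waveLp hb q)

theorem waveLp_add (p q : Poly) : waveLp hb u (p + q) = waveLp hb u p + waveLp hb u q := by
  rw [waveLp, waveLp, waveLp, ← MemLp.toLp_add]
  exact MemLp.toLp_congr _ _ (Eventually.of_forall fun x => by rw [wave_add])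

theorem waveLp_smul (c : ℂ) (p : Poly) : waveLp hb u (c • p) = c • waveLp hb u p := by
  rw [waveLp, waveLp, ← MemLp.toLp_const_smul]
  exact MemLp.toLp_congr _ _ (Eventually.of_forall fun x => by rw [wave_smul])

theorem waveLp_sub (p q : Poly) : waveLp hb u (p - q) = waveLp hb u p - waveLp hb u q := by
  rw [sub_eq_add_neg, sub_eq_add_neg, ← neg_one_smul ℂ q, ← neg_one_smul ℂ (waveLp hb u q),
    waveLp_add, waveLp_smul]

/-- The raising operator is minus the adjoint of the lowering operator. -/
theorem inner_waveLp_raise (p q : Poly) :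
    ⟪waveLp hb u p, waveLp hb v (raise b q)⟫_ℂ = -⟪waveLp hb u (lower p), waveLp hb v q⟫_ℂ := by
  -- Both momenta are symmetric. Since they are -i(R + D) and R - D whatever the centres u and v,
  -- averaging the two identities isolates R on one side and -D on the other.
  have h : ∀ j, ∫ x, conj (wave b u p x) * momentum b j (wave b v q) x =
      ∫ x, conj (momentum b j (wave b u p) x) * wave b v q x := fun j =>
    integral_conj_mul_momentum (contDiff_wave p) (contDiff_wave q) (decays_wave hb p)
      (decays_wave hb q) (decays_momentum_wave hb p j) (decays_momentum_wave hb q j)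
  have h0 := h 0
  have h1 := h 1
  simp only [momentum_zero_wave, ← inner_waveLp hb] at h0
  simp only [momentum_one_wave, ← inner_waveLp hb] at h1
  simp only [waveLp_smul, waveLp_add, waveLp_sub, inner_smul_left, inner_smul_right,
    inner_add_left, inner_add_right, inner_sub_left, inner_sub_right, map_neg,
    Complex.conj_I] at h0 h1
  have h2 : ⟪waveLp hb u p, waveLp hb v (raise b q)⟫_ℂ +
      ⟪waveLp hb u p, waveLp hb v (lower q)⟫_ℂ = -(⟪waveLp hb u (raise b p), waveLp hb v q⟫_ℂ +
      ⟪waveLp hb u (lower p), waveLp hb v q⟫_ℂ) := by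
    linear_combination (exp := 1) Complex.I * h0 + (⟪waveLp hb u p, waveLp hb v (raise b q)⟫_ℂ +
      ⟪waveLp hb u p, waveLp hb v (lower q)⟫_ℂ + ⟪waveLp hb u (raise b p), waveLp hb v q⟫_ℂ +
      ⟪waveLp hb u (lower p), waveLp hb v q⟫_ℂ) * (Complex.I_sq)
  linear_combination (h1 + h2) / 2

/-- Each R on the right moves to the left as -D, and `lower_raise_pow` strips one R there, producing
a factor (n + 1)b/2. -/
theorem inner_waveLp_raise_pow {p : Poly} (hp : lower p = 0) (n : ℕ) (q : Poly) :
    ⟪waveLp hb u ((raise b ^ n) p), waveLp hb v ((raise b ^ n) q)⟫_ℂ =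
      (n.factorial * (b / 2) ^ n : ℂ) * ⟪waveLp hb u p, waveLp hb v q⟫_ℂ := by
  induction n with
  | zero => simp
  | succ n ih =>
    rw [pow_succ' (raise b) n, Module.End.mul_apply (f := raise b) (x := q), inner_waveLp_raise,
      ← pow_succ', lower_raise_pow b hp, waveLp_smul, inner_smul_left, ih, Nat.factorial_succ]
    simp only [map_neg, map_mul, map_natCast, map_div₀, Complex.conj_ofReal, map_ofNat]
    push_cast
    ring

end levels

/-! ### Completeness of the waves -/

-- A test function is the Fourier transform of a Schwartz function r, and moving the transform from
-- r to h turns its integral against h into zero.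
open scoped FourierTransform in
theorem ae_eq_zero_of_fourier_eq_zero {V : Type*} [NormedAddCommGroup V]
    [InnerProductSpace ℝ V] [FiniteDimensional ℝ V] [MeasurableSpace V] [BorelSpace V]
    {h : V → ℂ} (hh : Integrable h) (h0 : ∀ t, 𝓕 h t = 0) : ∀ᵐ x, h x = 0 := by
  refine ae_eq_zero_of_integral_contDiff_smul_eq_zero hh.locallyIntegrable fun g hg hgc => ?_
  have hg₁ : HasCompactSupport (Complex.ofRealCLM ∘ g) := hgc.comp_left rfl
  have hg₂ : ContDiff ℝ ∞ (Complex.ofRealCLM ∘ g) := by fun_prop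
  let s : SchwartzMap V ℂ := hg₁.toSchwartzMap hg₂
  let r : SchwartzMap V ℂ := 𝓕⁻ s
  have key : ∫ x, 𝓕 (⇑r) x • h x = ∫ x, r x • 𝓕 h x := by
    simpa using! VectorFourier.integral_fourierIntegral_smul_eq_flip (L := innerₗ V)
      Real.continuous_fourierChar continuous_inner r.integrable hh
  rw [← SchwartzMap.fourier_coe, FourierTransform.fourier_fourierInv_eq] at key
  simp only [h0, smul_zero, integral_zero] at key
  simpa [s] using key

section completeness

theorem monomial_eq_X_pow (s : Fin 2 →₀ ℕ) (a : ℂ) :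
    (monomial s a : Poly) = a • (X 1 ^ s 1 * X 0 ^ s 0) := by
  rw [monomial_eq, Finsupp.prod_fintype _ _ (by simp), Fin.prod_univ_two, MvPolynomial.C_mul',
    mul_comm]

variable {b : ℝ} (hb : 0 < b) {ψ : L2 2}

theorem inner_waveLp_eq_zero_of_forall
    (h : ∀ n N : ℕ, ⟪waveLp hb 0 ((raise b ^ n) (X 0 ^ N)), ψ⟫_ℂ = 0) (p : Poly) :
    ⟪waveLp hb 0 p, ψ⟫_ℂ = 0 := by
  have key : ∀ l j n : ℕ, ⟪waveLp hb 0 ((raise b ^ n) (X 1 ^ l * X 0 ^ j)), ψ⟫_ℂ = 0 := by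
    intro l
    induction l with
    | zero => intro j n; simpa using h n j
    | succ l ih =>
      intro j n
      have hb' : (b : ℂ) ≠ 0 := by exact_mod_cast hb.ne'
      -- Solving the formula for R(z̄^l z^j) for its top term trades one power of z̄ for one R,
      -- whence the induction on l for all n at once. For j = 0 the truncated exponent j - 1 is
      -- harmless because its coefficient is j.
      have e : (X 1 ^ (l + 1) * X 0 ^ j : Poly) =
          (2 / b : ℂ) • ((j : ℂ) • (X 1 ^ l * X 0 ^ (j - 1)) - raise b (X 1 ^ l * X 0 ^ j)) := by
        have h1 : (raise b (X 1 ^ l * X 0 ^ j) : Poly) = (j : ℂ) • (X 1 ^ l * X 0 ^ (j - 1)) -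
            (b / 2 : ℂ) • (X 1 ^ (l + 1) * X 0 ^ j) := by
          rw [raise_apply]
          simp only [Derivation.leibniz, Derivation.leibniz_pow, pderiv_X_self,
            pderiv_X_of_ne (show (1 : Fin 2) ≠ 0 by decide), smul_eq_mul,
            mul_one]
          simp only [smul_eq_C_mul, nsmul_eq_mul, map_natCast]
          ring
        rw [h1, sub_sub_cancel, smul_smul, div_mul_div_cancel₀ hb', div_self two_ne_zero,
          one_smul]
      rw [e, map_smul, map_sub, map_smul, ← Module.End.mul_apply, ← pow_succ, waveLp_smul,
        waveLp_sub, waveLp_smul, inner_smul_left, inner_sub_left, inner_smul_left, ih, ih]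
      simp
  induction p using MvPolynomial.induction_on' with
  | monomial s a =>
    rw [monomial_eq_X_pow, waveLp_smul, inner_smul_left]
    simpa using Or.inr (key (s 1) (s 0) 0)
  | add p q hp hq => rw [waveLp_add, inner_add_left, hp, hq, add_zero]

theorem evalAt_linear (t x : Space 2) :
    evalAt 0 ((conj (coord t) / 2 : ℂ) • X 0 + (coord t / 2 : ℂ) • X 1) x =
      ((⟪x, t⟫_ℝ : ℝ) : ℂ) := by
  simp only [evalAt, map_add, smul_eval, eval_X, Matrix.cons_val_zero, Matrix.cons_val_one,
    sub_zero, map_zero, PiLp.inner_apply, Fin.sum_univ_two, coord, map_mul, Complex.conj_I,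
    Complex.conj_ofReal]
  simp
  ring_nf
  simp [Complex.I_sq]

/-- The polynomials times the Gaussian are dense. -/
theorem eq_zero_of_forall_inner_waveLp (h : ∀ p, ⟪waveLp hb 0 p, ψ⟫_ℂ = 0) : ψ = 0 := by
  let g : Space 2 → ℂ := gauss b 0
  have hgw : g = wave b 0 1 := by ext x; simp [g, wave, evalAt]
  have hgc : Continuous g := hgw ▸ continuous_wave 1
  have hgd : Decays g := decays_gauss hb
  have hgr : ∀ x, conj (g x) = g x := fun x => by
    have : g x = ((Real.exp (-(b / 4) * ‖x‖ ^ 2) : ℝ) : ℂ) := by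
      simp only [g, gauss, coord_mul_conj]; push_cast; simp
    rw [this, Complex.conj_ofReal]
  have hint : ∀ f : Space 2 → ℂ, Continuous f → ExpGrowth f →
      Integrable fun x => f x * (g x * ψ x) := fun f hf hfg => by
    have h1 : MemLp (fun x => g x * f x) 2 volume :=
      (hgd.mul_expGrowth hfg).memLp_two (hgc.mul hf).aestronglyMeasurable
    refine (h1.integrable_mul (Lp.memLp ψ)).congr (Eventually.of_forall fun x => ?_)
    simp only [Pi.mul_apply]
    ring
  have hh : Integrable fun x => g x * ψ x := by
    simpa using hint (fun _ => 1) continuous_const (expGrowth_const 1)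
  have hmom : ∀ (t : Space 2) (m : ℕ), ∫ x, ((⟪x, t⟫_ℝ : ℝ) : ℂ) ^ m * (g x * ψ x) = 0 := by
    intro t m
    have h1 := h (((conj (coord t) / 2 : ℂ) • X 0 + (coord t / 2 : ℂ) • X 1) ^ m)
    rw [inner_eq_integral (coeFn_waveLp hb _) (ae_eq_refl _)] at h1
    rw [← h1]
    refine integral_congr_ae (Eventually.of_forall fun x => ?_)
    have h2 := evalAt_linear t x
    simp only [evalAt] at h2
    simp only [wave, evalAt, map_mul, map_pow, h2, Complex.conj_ofReal]
    rw [show conj (gauss b 0 x) = g x from hgr x]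
    ring
  -- Expand the Fourier character in powers of ⟨x, t⟩: each term is a vanishing moment, and the
  -- series is dominated by e^{2π‖t‖‖x‖}|gψ|, integrable thanks to the Gaussian.
  have hfour : ∀ t, FourierTransform.fourier (fun x => g x * ψ x) t = 0 := by
    intro t
    rw [Real.fourier_eq']
    have hs := hasSum_integral_of_dominated_convergence (μ := (volume : Measure (Space 2)))
      (F := fun (m : ℕ) x => ((-2 * Real.pi * ⟪x, t⟫_ℝ : ℝ) * Complex.I : ℂ) ^ m / m.factorial *
        (g x * ψ x))
      (f := fun x => Complex.exp ((-2 * Real.pi * ⟪x, t⟫_ℝ : ℝ) * Complex.I) • (g x * ψ x))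
      (fun m x => (2 * Real.pi * ‖t‖ * ‖x‖) ^ m / m.factorial * ‖g x * ψ x‖) ?_ ?_ ?_ ?_ ?_
    · refine hs.unique ?_
      convert hasSum_zero with m
      have h1 : ∀ x : Space 2, ((-2 * Real.pi * ⟪x, t⟫_ℝ : ℝ) * Complex.I : ℂ) ^ m / m.factorial *
          (g x * ψ x) = (-2 * Real.pi * Complex.I : ℂ) ^ m / m.factorial *
          (((⟪x, t⟫_ℝ : ℝ) : ℂ) ^ m * (g x * ψ x)) := fun x => by
        push_cast
        rw [show (-2 * Real.pi * (⟪x, t⟫_ℝ : ℝ) * Complex.I : ℂ) =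
          (-2 * Real.pi * Complex.I) * (⟪x, t⟫_ℝ : ℝ) by ring, mul_pow]
        ring
      simp only [h1]
      rw [integral_const_mul, hmom, mul_zero]
    · intro m
      refine (Continuous.aestronglyMeasurable ?_).mul hh.aestronglyMeasurable
      fun_prop
    · refine fun m => Eventually.of_forall fun x => ?_
      rw [norm_mul, norm_div, norm_pow, norm_mul, Complex.norm_I, mul_one, Complex.norm_real,
        Complex.norm_natCast]
      have h1 : ‖-2 * Real.pi * ⟪x, t⟫_ℝ‖ ≤ 2 * Real.pi * ‖t‖ * ‖x‖ := by
        rw [norm_mul, norm_mul, norm_neg, Real.norm_of_nonneg Real.pi_pos.le, Real.norm_ofNat,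
          mul_assoc (2 * Real.pi), mul_comm ‖t‖]
        gcongr
        exact norm_inner_le_norm x t
      gcongr
    · refine Eventually.of_forall fun x => ?_
      exact (Real.summable_pow_div_factorial _).mul_right _
    · have h1 : ∀ x : Space 2, ∑' m : ℕ, (2 * Real.pi * ‖t‖ * ‖x‖) ^ m / m.factorial *
          ‖g x * ψ x‖ = ‖((Real.exp (2 * Real.pi * ‖t‖ * ‖x‖) : ℝ) : ℂ) * (g x * ψ x)‖ := by
        intro x
        rw [tsum_mul_right, norm_mul (Complex.ofReal _), Complex.norm_real, Real.norm_eq_abs,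
          Real.abs_exp, Real.exp_eq_exp_ℝ, NormedSpace.exp_eq_tsum_div]
      simp only [h1]
      refine (hint (fun x => ((Real.exp (2 * Real.pi * ‖t‖ * ‖x‖) : ℝ) : ℂ)) (by fun_prop)
        ⟨1, 2 * Real.pi * ‖t‖, fun x => ?_⟩).norm
      rw [Complex.norm_real, Real.norm_eq_abs, Real.abs_exp, one_mul]
    · refine Eventually.of_forall fun x => ?_
      have h1 := NormedSpace.expSeries_div_hasSum_exp
        ((-2 * Real.pi * ⟪x, t⟫_ℝ : ℝ) * Complex.I : ℂ)
      rw [← Complex.exp_eq_exp_ℂ] at h1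
      simpa [smul_eq_mul] using h1.mul_right (g x * ψ x)
  have h0 := ae_eq_zero_of_fourier_eq_zero hh hfour
  rw [Lp.eq_zero_iff_ae_eq_zero]
  filter_upwards [h0] with x hx
  exact (mul_eq_zero.1 hx).resolve_left (Complex.exp_ne_zero _)

/-- A vector in the `n`-th Landau level that is orthogonal to the waves of that level vanishes. -/
theorem eq_zero_of_mem_level {n : ℕ} (hψ : ψ ∈ level b n)
    (h : ∀ N : ℕ, ⟪waveLp hb 0 ((raise b ^ n) (X 0 ^ N)), ψ⟫_ℂ = 0) : ψ = 0 := by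
  refine eq_zero_of_forall_inner_waveLp hb (inner_waveLp_eq_zero_of_forall hb fun m N => ?_)
  rcases eq_or_ne m n with rfl | hmn
  · exact h N
  · refine inner_eq_zero_of_mem_level hb hmn (waveLp_mem_level hb ?_ m) hψ
    simp [lower_apply, Derivation.leibniz_pow, pderiv_X_of_ne (show (0 : Fin 2) ≠ 1 by decide)]

end completeness

/-! ### The reproducing kernel of a Landau level -/

theorem topologicalClosure_span_eq {H ι : Type*} [NormedAddCommGroup H] [InnerProductSpace ℂ H]
    [CompleteSpace H] {v : ι → H} {L : Submodule ℂ H} (hL : IsClosed (L : Set H))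
    (hv : ∀ i, v i ∈ L) (h : ∀ ψ ∈ L, (∀ i, ⟪v i, ψ⟫_ℂ = 0) → ψ = 0) :
    (Submodule.span ℂ (Set.range v)).topologicalClosure = L := by
  have hle : (Submodule.span ℂ (Set.range v)).topologicalClosure ≤ L :=
    Submodule.topologicalClosure_minimal _ (Submodule.span_le.2 (Set.range_subset_iff.2 hv)) hL
  have hbot : (Submodule.span ℂ (Set.range v)).topologicalClosureᗮ ⊓ L = ⊥ := by
    refine (Submodule.eq_bot_iff _).2 fun ψ hψ => h ψ hψ.2 fun i => ?_
    exact (Submodule.mem_orthogonal _ _).1 hψ.1 _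
      (Submodule.le_topologicalClosure _ (Submodule.subset_span ⟨i, rfl⟩))
  have : CompleteSpace (Submodule.span ℂ (Set.range v)).topologicalClosure :=
    (Submodule.isClosed_topologicalClosure _).completeSpace_coe
  have h2 := Submodule.sup_orthogonal_inf_of_hasOrthogonalProjection hle
  rwa [hbot, sup_bot_eq] at h2

theorem lower_X_zero_pow (N : ℕ) : lower (X 0 ^ N) = 0 := by
  simp [lower_apply, Derivation.leibniz_pow, pderiv_X_of_ne (show (0 : Fin 2) ≠ 1 by decide)]

theorem pderiv_zero_X_zero_pow (N : ℕ) :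
    pderiv 0 (X 0 ^ N : Poly) = (N : ℂ) • X 0 ^ (N - 1) := by
  simp [Derivation.leibniz_pow, smul_eq_C_mul]

theorem raise_pow_X_one_mul (b : ℝ) (n : ℕ) (p : Poly) :
    (raise b ^ n) (X 1 * p) = X 1 * (raise b ^ n) p := by
  induction n with
  | zero => simp
  | succ n ih =>
    rw [pow_succ', Module.End.mul_apply, Module.End.mul_apply, ih, raise_apply, raise_apply,
      Derivation.leibniz, pderiv_X_of_ne (show (1 : Fin 2) ≠ 0 by decide)]
    simp only [smul_eq_C_mul, smul_eq_mul]
    ring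

theorem raise_pow_succ_X_zero_pow (b : ℝ) (n N : ℕ) :
    (raise b ^ (n + 1)) (X 0 ^ N) = (N : ℂ) • (raise b ^ n) (X 0 ^ (N - 1)) -
      (b / 2 : ℂ) • (X 1 * (raise b ^ n) (X 0 ^ N)) := by
  rw [pow_succ, Module.End.mul_apply, raise_apply, pderiv_zero_X_zero_pow, map_sub, map_smul,
    map_smul, raise_pow_X_one_mul]

section kernel

variable {b : ℝ} (hb : 0 < b)

/-- The linear term has coefficient vector (b/2)z·(1, -i), whose sum of squares vanishes. Completing
the square therefore adds nothing, and the value is the same for all z. -/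
theorem integral_conj_gauss_mul_gauss (hb : 0 < b) (z : ℂ) :
    ∫ x, conj (gauss b z x) * gauss b 0 x = 2 * Real.pi / b := by
  have hb2 : 0 < ((b / 2 : ℝ) : ℂ).re := by rw [Complex.ofReal_re]; positivity
  have hb0 : (b : ℂ) ≠ 0 := by exact_mod_cast hb.ne'
  have key := GaussianFourier.integral_cexp_neg_mul_sum_add hb2
    ![(b / 2 : ℂ) * z, -(Complex.I * (b / 2) * z)]
  rw [← (PiLp.volume_preserving_toLp (Fin 2)).integral_comp
    (MeasurableEquiv.toLp 2 _).measurableEmbedding]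
  have h1 : ∀ v : Fin 2 → ℝ, conj (gauss b z (WithLp.toLp 2 v)) * gauss b 0 (WithLp.toLp 2 v) =
      Complex.exp (-((b / 2 : ℝ) : ℂ) * ∑ i, (v i : ℂ) ^ 2 +
        ∑ i, ![(b / 2 : ℂ) * z, -(Complex.I * (b / 2) * z)] i * v i) := fun v => by
    rw [gauss, gauss, ← Complex.exp_conj, ← Complex.exp_add]
    congr 1
    simp only [coord, map_add, map_neg, map_mul, map_div₀, Complex.conj_ofReal, Complex.conj_I,
      Complex.conj_conj, map_ofNat, map_zero, Fin.sum_univ_two, Matrix.cons_val_zero,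
      Matrix.cons_val_one]
    push_cast
    ring_nf
    simp only [Complex.I_sq]
    ring
  simp only [h1]
  rw [key]
  simp [Fin.sum_univ_two, mul_pow, Complex.I_sq]
  field_simp

theorem inner_waveLp_raise_left {u v : ℂ} (p q : Poly) :
    ⟪waveLp hb u (raise b p), waveLp hb v q⟫_ℂ = -⟪waveLp hb u p, waveLp hb v (lower q)⟫_ℂ := by
  rw [← inner_conj_symm, inner_waveLp_raise, map_neg, inner_conj_symm]

/-- R1 is a multiple of the variable z̄ centred at z. As Dq = 0, moving R across shows that q is
orthogonal to this wave; its conjugate is multiplication by the coordinate minus z. This is the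
reproducing property of the Bargmann–Fock space. -/
theorem inner_waveLp_one_X_zero_mul (z : ℂ) {q : Poly} (hq : lower q = 0) :
    ⟪waveLp hb z 1, waveLp hb 0 (X 0 * q)⟫_ℂ = z * ⟪waveLp hb z 1, waveLp hb 0 q⟫_ℂ := by
  have h1 := inner_waveLp_raise_left hb (u := z) (v := 0) 1 q
  have hb0 : (b : ℂ) ≠ 0 := by exact_mod_cast hb.ne'
  have h2 : raise b 1 = (-(b / 2) : ℂ) • X 1 := by
    rw [raise_apply, Derivation.map_one_eq_zero, mul_one, zero_sub, neg_smul]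
  have h3 : waveLp hb 0 (0 : Poly) = 0 := by
    simpa using waveLp_smul hb (u := 0) 0 (0 : Poly)
  rw [hq, h3, inner_zero_right, neg_zero, h2, waveLp_smul, inner_smul_left] at h1
  have h4 : ⟪waveLp hb z (X 1), waveLp hb 0 q⟫_ℂ = 0 := by
    refine (mul_eq_zero.1 h1).resolve_left ?_
    simpa using hb.ne'
  have h5 : ⟪waveLp hb z (X 1), waveLp hb 0 q⟫_ℂ =
      ⟪waveLp hb z 1, waveLp hb 0 (X 0 * q - z • q)⟫_ℂ := by
    rw [inner_waveLp, inner_waveLp]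
    congr 1
    ext x
    simp [wave, evalAt, smul_eval]
    ring
  rw [h4, waveLp_sub, waveLp_smul, inner_sub_right, inner_smul_right] at h5
  exact (sub_eq_zero.1 h5.symm)

theorem inner_waveLp_one_X_zero_pow (z : ℂ) (N : ℕ) :
    ⟪waveLp hb z 1, waveLp hb 0 (X 0 ^ N)⟫_ℂ = 2 * Real.pi / b * z ^ N := by
  induction N with
  | zero =>
    rw [inner_waveLp, pow_zero, pow_zero, mul_one, ← integral_conj_gauss_mul_gauss hb z]
    simp [wave, evalAt]
  | succ N ih =>
    rw [pow_succ', inner_waveLp_one_X_zero_mul hb z (lower_X_zero_pow N), ih]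
    ring

/-- The raising operator with the conjugate coordinate frozen. -/
def raiseFrozen (b : ℝ) (z : ℂ) : Poly →ₗ[ℂ] Poly :=
  (pderiv 0).toLinearMap - (b / 2 * conj z : ℂ) • LinearMap.id

theorem raiseFrozen_apply (z : ℂ) (p : Poly) :
    raiseFrozen b z p = pderiv 0 p - (b / 2 * conj z : ℂ) • p := rfl

/-- Moved to the right, the centred coordinate becomes the conjugate coordinate minus z̄, which is
(2/b) times the frozen raising operator minus R. The R term vanishes because Dp = 0. -/
theorem inner_waveLp_X_zero_mul (z : ℂ) {p : Poly} (hp : lower p = 0) (q : Poly) :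
    ⟪waveLp hb z (X 0 * p), waveLp hb 0 q⟫_ℂ =
      2 / b * ⟪waveLp hb z p, waveLp hb 0 (raiseFrozen b z q)⟫_ℂ := by
  have h1 := inner_waveLp_raise hb (u := z) (v := 0) p q
  have hb0 : (b : ℂ) ≠ 0 := by exact_mod_cast hb.ne'
  have h3 : waveLp hb z (0 : Poly) = 0 := by
    simpa using waveLp_smul hb (u := z) 0 (0 : Poly)
  rw [hp, h3, inner_zero_left, neg_zero] at h1
  have h2 : ⟪waveLp hb z (X 0 * p), waveLp hb 0 q⟫_ℂ =
      ⟪waveLp hb z p, waveLp hb 0 ((2 / b : ℂ) • (raiseFrozen b z q - raise b q))⟫_ℂ := by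
    rw [inner_waveLp, inner_waveLp]
    congr 1
    ext x
    simp [wave, evalAt, smul_eval, raise_apply, raiseFrozen_apply]
    field_simp
  rw [h2, waveLp_smul, waveLp_sub, inner_smul_right, inner_sub_right, h1, sub_zero]

theorem inner_waveLp_X_zero_pow (z : ℂ) (n : ℕ) (q : Poly) :
    ⟪waveLp hb z (X 0 ^ n), waveLp hb 0 q⟫_ℂ =
      (2 / b) ^ n * ⟪waveLp hb z 1, waveLp hb 0 ((raiseFrozen b z ^ n) q)⟫_ℂ := by
  induction n generalizing q with
  | zero => simp
  | succ n ih =>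
    rw [pow_succ', inner_waveLp_X_zero_mul hb z (lower_X_zero_pow n), ih,
      pow_succ (raiseFrozen b z), Module.End.mul_apply]
    ring

/-- The frozen operator keeps polynomials in z holomorphic, so the reproducing property evaluates
the result at z. There freezing is invisible, because ∂_z commutes with multiplication by the
conjugate coordinate. -/
theorem inner_waveLp_one_raiseFrozen_pow (z : ℂ) (n N : ℕ) :
    ⟪waveLp hb z 1, waveLp hb 0 ((raiseFrozen b z ^ n) (X 0 ^ N))⟫_ℂ =
      2 * Real.pi / b * eval ![z, conj z] ((raise b ^ n) (X 0 ^ N)) := by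
  induction n generalizing N with
  | zero => simpa using inner_waveLp_one_X_zero_pow hb z N
  | succ n ih =>
    rw [pow_succ, Module.End.mul_apply, raiseFrozen_apply, pderiv_zero_X_zero_pow, map_sub,
      map_smul, map_smul, waveLp_sub, waveLp_smul, waveLp_smul, inner_sub_right,
      inner_smul_right, inner_smul_right, ih, ih, raise_pow_succ_X_zero_pow]
    simp [smul_eval]
    ring

/-- This is the reproducing formula of level n. Removing R^n from both sides gives n!(b/2)^n, and
removing the centred monomial gives (2/b)^n times frozen raisings. -/
theorem inner_waveLp_raise_pow_X_zero_pow (z : ℂ) (n N : ℕ) :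
    ⟪waveLp hb z ((raise b ^ n) (X 0 ^ n)), waveLp hb 0 ((raise b ^ n) (X 0 ^ N))⟫_ℂ =
      n.factorial * (2 * Real.pi / b) * eval ![z, conj z] ((raise b ^ n) (X 0 ^ N)) := by
  have hb0 : (b : ℂ) ≠ 0 := by exact_mod_cast hb.ne'
  rw [inner_waveLp_raise_pow hb (lower_X_zero_pow n), inner_waveLp_X_zero_pow,
    inner_waveLp_one_raiseFrozen_pow]
  have : (b / 2 : ℂ) ^ n * (2 / b) ^ n = 1 := by
    rw [← mul_pow, div_mul_div_cancel₀ two_ne_zero, div_self hb0, one_pow]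
  linear_combination (n.factorial * (2 * Real.pi / b) *
    eval ![z, conj z] ((raise b ^ n) (X 0 ^ N))) * this

theorem topologicalClosure_span_waveLp (n : ℕ) :
    (Submodule.span ℂ (Set.range fun N : ℕ =>
      waveLp hb 0 ((raise b ^ n) (X 0 ^ N)))).topologicalClosure = level b n :=
  topologicalClosure_span_eq (isClosed_level b n)
    (fun N => waveLp_mem_level hb (lower_X_zero_pow N) n) fun _ hψ h =>
      eq_zero_of_mem_level hb hψ h

/-- The value at `x` of the projection onto the `n`-th level, for a function in the level. -/
theorem ae_eq_inner_of_mem_level {n : ℕ} {ψ : L2 2} (hψ : ψ ∈ level b n) :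
    (ψ : Space 2 → ℂ) =ᵐ[volume] fun x => (b / (2 * Real.pi * n.factorial) : ℂ) * gauss b 0 x *
      ⟪waveLp hb (coord x) ((raise b ^ n) (X 0 ^ n)), ψ⟫_ℂ := by
  have hb0 : (b : ℂ) ≠ 0 := by exact_mod_cast hb.ne'
  have hpi : (Real.pi : ℂ) ≠ 0 := by exact_mod_cast Real.pi_ne_zero
  have hfac : (n.factorial : ℂ) ≠ 0 := by exact_mod_cast n.factorial_ne_zero
  set T : L2 2 → Space 2 → ℂ := fun ψ x => (b / (2 * Real.pi * n.factorial) : ℂ) * gauss b 0 x *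
      ⟪waveLp hb (coord x) ((raise b ^ n) (X 0 ^ n)), ψ⟫_ℂ with hT
  have hspan : ∀ χ ∈ Submodule.span ℂ (Set.range fun N : ℕ =>
      waveLp hb 0 ((raise b ^ n) (X 0 ^ N))), (χ : Space 2 → ℂ) =ᵐ[volume] T χ := by
    intro χ hχ
    induction hχ using Submodule.span_induction with
    | mem χ h =>
      obtain ⟨N, rfl⟩ := h
      refine (coeFn_waveLp hb _).trans (Eventually.of_forall fun x => ?_)
      simp only [hT, inner_waveLp_raise_pow_X_zero_pow, wave, evalAt, sub_zero, map_zero]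
      field_simp
    | zero =>
      refine (Lp.coeFn_zero _ _ _).trans (Eventually.of_forall fun x => ?_)
      simp [hT]
    | add χ χ' _ _ h h' =>
      filter_upwards [Lp.coeFn_add χ χ', h, h'] with x h1 h2 h3
      rw [h1, Pi.add_apply, h2, h3]
      simp only [hT, inner_add_right]
      ring
    | smul c χ _ h =>
      filter_upwards [Lp.coeFn_smul c χ, h] with x h1 h2
      rw [h1, Pi.smul_apply, h2]
      simp only [hT, inner_smul_right, smul_eq_mul]
      ring
  -- Approximate ψ from the span: a subsequence converges almost everywhere, while the right side is
  -- continuous in ψ at every x.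
  rw [← topologicalClosure_span_waveLp hb] at hψ
  obtain ⟨χ, hχ, hlim⟩ := mem_closure_iff_seq_limit.1 hψ
  obtain ⟨ns, hns, hae⟩ := (tendstoInMeasure_of_tendsto_Lp hlim).exists_seq_tendsto_ae
  have hall : ∀ᵐ x, ∀ k, (χ k : Space 2 → ℂ) x = T (χ k) x :=
    ae_all_iff.2 fun k => hspan _ (hχ k)
  filter_upwards [hae, hall] with x h1 h2
  refine tendsto_nhds_unique h1 ?_
  simp only [h2]
  have h3 : Continuous fun φ => T φ x := by simp only [hT]; fun_prop
  exact (h3.tendsto ψ).comp (hlim.comp hns.tendsto_atTop)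

/-- The factor at x is the normalization omitted from the translated Gaussian; with it the modulus
depends on x - y only. -/
theorem norm_gauss_mul_gauss (x y : Space 2) :
    ‖gauss b 0 x‖ * ‖gauss b (coord x) y‖ = ‖gauss b 0 (x - y)‖ := by
  rw [norm_gauss, norm_gauss, norm_gauss, ← Real.exp_add]
  congr 1
  simp only [← norm_coord, coord_sub, ← Complex.normSq_eq_norm_sq, Complex.normSq_apply]
  simp
  ring

theorem isExpLocalized_levelProj (hb : 0 < b) (n : ℕ) {β : ℝ} (hβ : 0 < β) :
    IsExpLocalized β (levelProj b n) := by
  set p : Poly := (raise b ^ n) (X 0 ^ n)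
  have hw : ∀ x y : Space 2, wave b (coord x) p y = evalAt 0 p (y - x) * gauss b (coord x) y :=
    fun x y => by simp [wave, evalAt, coord_sub]
  have hev : Continuous (evalAt 0 p) := by
    have h := contDiff_wave (b := 0) (u := 0) p
    have h2 : wave 0 0 p = evalAt 0 p := by ext x; simp [wave, gauss]
    exact h2 ▸ h.continuous
  obtain ⟨C, hC⟩ := decays_wave hb (u := 0) p β
  have hsym : ∀ x y : Space 2, ‖gauss b 0 (x - y)‖ = ‖gauss b 0 (y - x)‖ := fun x y => by
    simp [norm_gauss, norm_sub_rev]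
  -- The summand 1 only makes the constant strictly positive.
  refine ⟨hβ, fun z => (b / (2 * Real.pi * n.factorial) : ℂ) * gauss b 0 z.1 *
    conj (wave b (coord z.1) p z.2), ?_, ⟨‖(b / (2 * Real.pi * n.factorial) : ℂ)‖ * C + 1, ?_, ?_⟩,
    ?_⟩
  · apply Continuous.measurable
    have hc1 : Continuous fun z : Space 2 × Space 2 => coord z.1 :=
      continuous_coord.comp continuous_fst
    have hc2 : Continuous fun z : Space 2 × Space 2 => coord z.2 :=
      continuous_coord.comp continuous_snd
    simp only [hw, gauss]
    refine (continuous_const.mul ?_).mul (Complex.continuous_conj.comp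
      ((hev.comp (continuous_snd.sub continuous_fst)).mul ?_))
    · fun_prop
    · fun_prop
  · have hC0 : 0 ≤ C := by simpa using (norm_nonneg _).trans (hC 0)
    positivity
  · intro x y
    have h1 := hC (y - x)
    simp only [wave] at h1
    rw [norm_mul] at h1
    dsimp only
    rw [norm_mul, norm_mul, RCLike.norm_conj, hw, norm_mul, norm_sub_rev x y]
    calc _ = ‖(b / (2 * Real.pi * n.factorial) : ℂ)‖ * (‖evalAt 0 p (y - x)‖ *
          (‖gauss b 0 x‖ * ‖gauss b (coord x) y‖)) := by ring
      _ ≤ ‖(b / (2 * Real.pi * n.factorial) : ℂ)‖ * (C * Real.exp (-β * ‖y - x‖)) := by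
          rw [norm_gauss_mul_gauss, hsym]; gcongr
      _ ≤ _ := by nlinarith [Real.exp_pos (-β * ‖y - x‖)]
  · intro ψ
    have hmem : levelProj b n ψ ∈ level b n := Submodule.starProjection_apply_mem _ _
    refine (ae_eq_inner_of_mem_level hb hmem).trans (Eventually.of_forall fun x => ?_)
    dsimp only
    have h1 : ⟪waveLp hb (coord x) p, levelProj b n ψ⟫_ℂ = ⟪waveLp hb (coord x) p, ψ⟫_ℂ := by
      rw [levelProj, ← Submodule.inner_starProjection_left_eq_right,
        Submodule.starProjection_eq_self_iff.2 (waveLp_mem_level hb (lower_X_zero_pow n) n)]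
    rw [h1, inner_eq_integral (coeFn_waveLp hb p) (ae_eq_refl _), ← integral_const_mul]
    simp only [mul_assoc]

end kernel

/-! ### Recurrences for the Laguerre polynomials -/

theorem binom_zero (α : ℝ) : binom α 0 = 1 := by simp [binom]

theorem succ_mul_binom_succ_right (α : ℝ) (m : ℕ) :
    (m + 1) * binom α (m + 1) = (α - m) * binom α m := by
  have h : (m.factorial : ℝ) ≠ 0 := by positivity
  rw [binom, binom, Finset.prod_range_succ, Nat.factorial_succ]
  push_cast
  field_simp

theorem succ_mul_binom_succ (α : ℝ) (m : ℕ) :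
    (m + 1) * binom (α + 1) (m + 1) = (α + 1) * binom α m := by
  have h : (m.factorial : ℝ) ≠ 0 := by positivity
  rw [binom, binom, Finset.prod_range_succ', Nat.factorial_succ]
  push_cast
  simp only [add_sub_add_right_eq_sub, sub_zero]
  field_simp

theorem binom_succ_succ (α : ℝ) (m : ℕ) :
    binom (α + 1) (m + 1) = binom α (m + 1) + binom α m := by
  have h : (m + 1 : ℝ) ≠ 0 := by positivity
  have h1 := succ_mul_binom_succ α m
  have h2 := succ_mul_binom_succ_right α m
  apply mul_left_cancel₀ h
  linear_combination h1 - h2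

theorem laguerre_succ (n : ℕ) (α ξ : ℝ) :
    (n + 1) * laguerre (n + 1) α ξ =
      (n + 1 + α) * laguerre n α ξ - ξ * laguerre n (α + 1) ξ := by
  -- Split the factor n + 1 as (n + 1 - m) + m in the m-th coefficient. The first half lowers the
  -- binomial and gives degree n; the second cancels against m! and, after a shift, gives -ξ times
  -- degree n with parameter α + 1.
  have h1 : (n + 1) * laguerre (n + 1) α ξ = (∑ m ∈ Finset.range (n + 2),
      ((n + 1 - m : ℝ) * binom (n + 1 + α) (n + 1 - m)) * ((-ξ) ^ m / m.factorial)) +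
      ∑ m ∈ Finset.range (n + 2),
        m * (binom (n + 1 + α) (n + 1 - m) * ((-ξ) ^ m / m.factorial)) := by
    rw [laguerre, Finset.mul_sum, ← Finset.sum_add_distrib]
    refine Finset.sum_congr rfl fun m _ => ?_
    push_cast
    ring
  rw [h1, Finset.sum_range_succ, Finset.sum_range_succ' _ (n + 1)]
  have h2 : ∑ m ∈ Finset.range (n + 1), ((n + 1 - m : ℝ) * binom (n + 1 + α) (n + 1 - m)) *
      ((-ξ) ^ m / m.factorial) = (n + 1 + α) * laguerre n α ξ := by
    rw [laguerre, Finset.mul_sum]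
    refine Finset.sum_congr rfl fun m hm => ?_
    have hmn : m ≤ n := Nat.lt_succ_iff.1 (Finset.mem_range.1 hm)
    obtain ⟨j, rfl⟩ := Nat.exists_eq_add_of_le hmn
    have h3 := succ_mul_binom_succ ((m + j : ℕ) + α) j
    rw [show m + j + 1 - m = j + 1 by omega, show m + j - m = j by omega]
    push_cast at h3 ⊢
    rw [show (m + j + 1 - m : ℝ) = j + 1 by ring, show (m + j + 1 + α : ℝ) = m + j + α + 1 by ring,
      h3]
    ring
  have h4 : ∑ m ∈ Finset.range (n + 1), ((m + 1 : ℕ) : ℝ) * (binom (n + 1 + α) (n + 1 - (m + 1)) *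
      ((-ξ) ^ (m + 1) / (m + 1).factorial)) = -(ξ * laguerre n (α + 1) ξ) := by
    rw [laguerre, Finset.mul_sum, ← Finset.sum_neg_distrib]
    refine Finset.sum_congr rfl fun m _ => ?_
    have h : (m.factorial : ℝ) ≠ 0 := by positivity
    rw [Nat.add_sub_add_right, Nat.factorial_succ, show (n + 1 + α : ℝ) = n + (α + 1) by ring]
    push_cast
    field_simp
    ring
  rw [h2, h4]
  push_cast
  ring

theorem laguerre_add_one (n : ℕ) (α ξ : ℝ) :
    laguerre (n + 1) (α + 1) ξ = laguerre (n + 1) α ξ + laguerre n (α + 1) ξ := by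
  rw [laguerre, laguerre, laguerre, Finset.sum_range_succ, Finset.sum_range_succ _ (n + 1)]
  have h : ∑ m ∈ Finset.range (n + 1), binom ((n + 1 : ℕ) + (α + 1)) (n + 1 - m) *
      ((-ξ) ^ m / m.factorial) = ∑ m ∈ Finset.range (n + 1),
      binom ((n + 1 : ℕ) + α) (n + 1 - m) * ((-ξ) ^ m / m.factorial) +
      ∑ m ∈ Finset.range (n + 1), binom (n + (α + 1)) (n - m) * ((-ξ) ^ m / m.factorial) := by
    rw [← Finset.sum_add_distrib]
    refine Finset.sum_congr rfl fun m hm => ?_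
    have hmn : m ≤ n := Nat.lt_succ_iff.1 (Finset.mem_range.1 hm)
    obtain ⟨j, rfl⟩ := Nat.exists_eq_add_of_le hmn
    have h3 := binom_succ_succ ((m + j + 1 : ℕ) + α) j
    rw [show m + j + 1 - m = j + 1 by omega, show m + j - m = j by omega, ← add_assoc, h3]
    push_cast
    rw [show (m + j + (α + 1) : ℝ) = m + j + 1 + α by ring]
    ring
  rw [h]
  simp only [Nat.sub_self, binom_zero]
  ring

theorem laguerre_zero (α ξ : ℝ) : laguerre 0 α ξ = 1 := by simp [laguerre, binom_zero]

/-! ### The Laguerre functions -/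

/-- R^{n+1} z^N = N R^n z^{N-1} - (b/2) z̄ R^n z^N is `laguerre_succ` with α = N - n - 1 and ξ =
b|z|²/2, as z z̄ = |z|². The point z = 0 is excluded because z^{N-n} may be a negative power. -/
theorem eval_raise_pow_X_zero_pow (b : ℝ) (n N : ℕ) {z : ℂ} (hz : z ≠ 0) :
    eval ![z, conj z] ((raise b ^ n) (X 0 ^ N)) = n.factorial * z ^ ((N : ℤ) - n) *
      (laguerre n ((N : ℝ) - n) (b * ‖z‖ ^ 2 / 2) : ℂ) := by
  induction n generalizing N with
  | zero => simp [laguerre_zero]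
  | succ n ih =>
    have hrec := congrArg (fun r : ℝ => (r : ℂ))
      (laguerre_succ n ((N : ℝ) - (n + 1)) (b * ‖z‖ ^ 2 / 2))
    rw [show (n + 1 + (N - (n + 1)) : ℝ) = N by ring, show (N - (n + 1) + 1 : ℝ) = N - n by ring]
      at hrec
    push_cast at hrec
    rw [raise_pow_succ_X_zero_pow]
    simp only [map_sub, smul_eval, map_mul, eval_X, ih N, Matrix.cons_val_one,
      Matrix.cons_val_fin_one]
    have h1 : (N : ℂ) * eval ![z, conj z] ((raise b ^ n) (X 0 ^ (N - 1))) = n.factorial *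
        z ^ ((N : ℤ) - (n + 1)) * (N * laguerre n ((N : ℝ) - (n + 1)) (b * ‖z‖ ^ 2 / 2) : ℂ) := by
      cases N with
      | zero => simp
      | succ N =>
        rw [Nat.add_sub_cancel, ih N]
        push_cast
        rw [show (N + 1 - (n + 1) : ℤ) = N - n by ring, show (N + 1 - (n + 1) : ℝ) = N - n by ring]
        ring
    have h2 : z ^ ((N : ℤ) - n) = z ^ ((N : ℤ) - (n + 1)) * z := by
      rw [← zpow_add_one₀ hz]; congr 1; ring
    have h3 : z * conj z = (‖z‖ : ℂ) ^ 2 := by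
      rw [Complex.mul_conj, Complex.normSq_eq_norm_sq]; push_cast; ring
    rw [h1, h2, Nat.factorial_succ]
    push_cast
    linear_combination (-(n.factorial : ℂ) * z ^ ((N : ℤ) - (n + 1))) * hrec -
      (b / 2 * n.factorial * z ^ ((N : ℤ) - (n + 1)) *
        laguerre n ((N : ℝ) - n) (b * ‖z‖ ^ 2 / 2)) * h3

/-- At the origin the z̄ term drops out and only N derivatives of z^N survive. Through the
reproducing formula at z = 0 this gives the orthogonality and norms of the waves. -/
theorem eval_zero_raise_pow_X_zero_pow (b : ℝ) (n N : ℕ) :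
    eval ![0, 0] ((raise b ^ n) (X 0 ^ N)) = if n = N then (N.factorial : ℂ) else 0 := by
  induction n generalizing N with
  | zero => cases N <;> simp
  | succ n ih =>
    rw [raise_pow_succ_X_zero_pow]
    simp only [map_sub, smul_eval, map_mul, eval_X, Matrix.cons_val_one, Matrix.cons_val_fin_one,
      zero_mul, mul_zero, sub_zero, ih]
    cases N with
    | zero => simp
    | succ N => simp [Nat.factorial_succ]

/-- The exponent `k + n ≥ 0`. -/
def degree (n : ℕ) (k : Index n) : ℕ := (k.1 + n).toNat

theorem degree_cast (n : ℕ) (k : Index n) : (degree n k : ℤ) = k.1 + n :=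
  Int.toNat_of_nonneg (by linarith [k.2])

theorem degree_injective (n : ℕ) : Function.Injective (degree n) := fun k l h => by
  have h1 := degree_cast n k
  have h2 := degree_cast n l
  rw [h] at h1
  exact Subtype.ext (by linarith)

/-- The index with a given exponent. -/
def indexOf (n N : ℕ) : Index n := ⟨(N : ℤ) - n, by linarith [Int.natCast_nonneg N]⟩

theorem degree_indexOf (n N : ℕ) : degree n (indexOf n N) = N := by
  simp [degree, indexOf]

theorem factorialRatio_eq (n : ℕ) (k : Index n) :
    factorialRatio n k = n.factorial / (degree n k).factorial := rfl

theorem factorialRatio_pos (n : ℕ) (k : Index n) : 0 < factorialRatio n k := by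
  rw [factorialRatio_eq]; positivity

/-- The factor between a Laguerre function and the corresponding wave. -/
def waveCoeff (b : ℝ) (n : ℕ) (k : Index n) : ℝ :=
  √(factorialRatio n k) * √(b / 2) ^ k.1 * √(b / (2 * Real.pi)) / n.factorial

/-! ### Orthonormality and completeness of the Laguerre functions -/

section basis

variable {b : ℝ} (hb : 0 < b) (n : ℕ)

theorem laguerreFun_eq (k : Index n) {x : Space 2} (hx : x ≠ 0) :
    laguerreFun b n k x = (waveCoeff b n k : ℂ) *
      wave b 0 ((raise b ^ n) (X 0 ^ degree n k)) x := by
  have hz : coord x ≠ 0 := by rwa [← norm_ne_zero_iff, norm_coord, norm_ne_zero_iff]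
  have hfac : (n.factorial : ℂ) ≠ 0 := by exact_mod_cast n.factorial_ne_zero
  have hk : ((degree n k : ℤ) - n : ℤ) = k.1 := by rw [degree_cast]; ring
  have hk' : ((degree n k : ℝ) - n : ℝ) = k.1 := by rw [← hk]; push_cast; ring
  have hg : gauss b 0 x = (Real.exp (-(b * ‖x‖ ^ 2) / 4) : ℂ) := by
    rw [gauss, coord_mul_conj]; push_cast; simp; ring_nf
  have h1 := eval_raise_pow_X_zero_pow b n (degree n k) hz
  rw [hk, hk', norm_coord] at h1
  rw [wave, evalAt, hg, map_zero, sub_zero, sub_zero, h1, laguerreFun, ← coord, mul_zpow, waveCoeff]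
  push_cast
  field_simp

/-- The Laguerre function `φ_{n,k}` as an element of `L²(ℝ²)`. -/
def laguerreLp (k : Index n) : L2 2 :=
  (waveCoeff b n k : ℂ) • waveLp hb 0 ((raise b ^ n) (X 0 ^ degree n k))

theorem coeFn_laguerreLp_wave (k : Index n) :
    (laguerreLp hb n k : Space 2 → ℂ) =ᵐ[volume]
      fun x => (waveCoeff b n k : ℂ) * wave b 0 ((raise b ^ n) (X 0 ^ degree n k)) x :=
  (Lp.coeFn_smul _ _).trans ((coeFn_waveLp hb _).const_smul _)

theorem coeFn_laguerreLp (k : Index n) :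
    (laguerreLp hb n k : Space 2 → ℂ) =ᵐ[volume] laguerreFun b n k := by
  filter_upwards [coeFn_laguerreLp_wave hb n k, Measure.ae_ne volume (0 : Space 2)] with x h1 hx
  rw [h1, laguerreFun_eq n k hx]

theorem laguerreLp_mem_level (k : Index n) : laguerreLp hb n k ∈ level b n :=
  Submodule.smul_mem _ _ (waveLp_mem_level hb (lower_X_zero_pow _) n)

theorem waveCoeff_pos (hb : 0 < b) (k : Index n) : 0 < waveCoeff b n k := by
  have := factorialRatio_pos n k
  unfold waveCoeff
  positivity

theorem orthonormal_laguerreLp : Orthonormal ℂ (laguerreLp hb n) := by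
  classical
  rw [orthonormal_iff_ite]
  intro k l
  have hb0 : (b : ℂ) ≠ 0 := by exact_mod_cast hb.ne'
  rw [laguerreLp, laguerreLp, inner_smul_left, inner_smul_right,
    inner_waveLp_raise_pow hb (lower_X_zero_pow _), inner_waveLp_X_zero_pow,
    inner_waveLp_one_raiseFrozen_pow, map_zero, eval_zero_raise_pow_X_zero_pow]
  by_cases hkl : k = l
  · subst hkl
    have h2 : waveCoeff b n k * waveCoeff b n k * (n.factorial * (b / 2) ^ n *
        ((2 / b) ^ degree n k * (2 * Real.pi / b * (degree n k).factorial))) = 1 := by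
      have hpow : (√(b / 2) ^ k.1) ^ 2 * (b / 2) ^ n = (b / 2) ^ degree n k := by
        rw [sq, ← mul_zpow, Real.mul_self_sqrt (by positivity), ← zpow_natCast, ← zpow_natCast,
          ← zpow_add₀ (by positivity), degree_cast]
      have hr := Real.sq_sqrt (factorialRatio_pos n k).le
      have hp := Real.sq_sqrt (show 0 ≤ b / (2 * Real.pi) by positivity)
      have h1 : (b / 2) ^ degree n k * (2 / b) ^ degree n k = 1 := by
        rw [← mul_pow, div_mul_div_cancel₀ two_ne_zero, div_self hb.ne', one_pow]
      have hfac : (n.factorial : ℝ) ≠ 0 := by positivity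
      have hfac' : ((degree n k).factorial : ℝ) ≠ 0 := by positivity
      calc _ = √(factorialRatio n k) ^ 2 * √(b / (2 * Real.pi)) ^ 2 / n.factorial *
            ((√(b / 2) ^ k.1) ^ 2 * (b / 2) ^ n) * ((2 / b) ^ degree n k *
            (2 * Real.pi / b * (degree n k).factorial)) := by
              rw [waveCoeff]; field_simp
        _ = factorialRatio n k * (b / (2 * Real.pi)) / n.factorial *
            ((b / 2) ^ degree n k * (2 / b) ^ degree n k) *
            (2 * Real.pi / b * (degree n k).factorial) := by rw [hpow, hr, hp]; ring
        _ = 1 := by rw [h1, factorialRatio_eq]; field_simp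
    rw [if_pos rfl, if_pos rfl, Complex.conj_ofReal, ← Complex.ofReal_one, ← h2]
    push_cast
    ring
  · rw [if_neg hkl, if_neg fun h => hkl (degree_injective n h)]
    simp

theorem eq_zero_of_mem_level_of_inner_laguerreLp {ψ : L2 2} (hψ : ψ ∈ level b n)
    (h : ∀ k, ⟪laguerreLp hb n k, ψ⟫_ℂ = 0) : ψ = 0 := by
  refine eq_zero_of_mem_level hb hψ fun N => ?_
  have h1 := h (indexOf n N)
  rw [laguerreLp, degree_indexOf, inner_smul_left, Complex.conj_ofReal] at h1
  exact (mul_eq_zero.1 h1).resolve_left (by exact_mod_cast (waveCoeff_pos n hb _).ne')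

theorem topologicalClosure_span_laguerreLp :
    (Submodule.span ℂ (Set.range (laguerreLp hb n))).topologicalClosure = level b n :=
  topologicalClosure_span_eq (isClosed_level b n) (laguerreLp_mem_level hb n)
    fun _ hψ h => eq_zero_of_mem_level_of_inner_laguerreLp hb n hψ h

/-! ### Radial densities -/

/-- The density of `|φ_{n,k}|²` in the variable `ξ = b‖x‖²/2`. -/
def radialDensity (n : ℕ) (k : Index n) (ξ : ℝ) : ℝ :=
  factorialRatio n k * (Real.exp (-ξ) * ξ ^ k.1 * laguerre n (k.1 : ℝ) ξ ^ 2)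

theorem norm_laguerreFun_sq (hb : 0 < b) (k : Index n) (x : Space 2) :
    ‖laguerreFun b n k x‖ ^ 2 = b / (2 * Real.pi) * radialDensity n k (b * ‖x‖ ^ 2 / 2) := by
  have hz : ‖((√(b / 2) : ℂ) * ((x 0 : ℂ) + Complex.I * (x 1 : ℂ))) ^ k.1‖ ^ 2 =
      (b * ‖x‖ ^ 2 / 2) ^ k.1 := by
    rw [← coord, norm_zpow, norm_mul, norm_coord, Complex.norm_real, Real.norm_eq_abs,
      abs_of_nonneg (Real.sqrt_nonneg _), sq, ← mul_zpow, ← sq, mul_pow,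
      Real.sq_sqrt (by positivity)]
    congr 1
    ring
  rw [laguerreFun, norm_mul, norm_mul, norm_mul, norm_mul, mul_pow, mul_pow, mul_pow, mul_pow, hz]
  simp only [Complex.norm_real, Real.norm_eq_abs, sq_abs]
  rw [Real.sq_sqrt (factorialRatio_pos n k).le, Real.sq_sqrt (by positivity), ← Real.exp_nat_mul,
    radialDensity]
  push_cast
  rw [show 2 * (-(b * ‖x‖ ^ 2) / 4) = -(b * ‖x‖ ^ 2 / 2) by ring]
  ring

theorem integrable_comp_norm_sq (hb : 0 < b) {g : ℝ → ℝ} :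
    Integrable (fun x : Space 2 => g (b * ‖x‖ ^ 2 / 2)) ↔ IntegrableOn g (Set.Ioi 0) := by
  have h := integrableOn_Ioi_comp_mul_left_iff g 0 (show 0 < b / 2 by positivity)
  rw [mul_zero] at h
  rw [integrable_fun_norm_addHaar volume (f := fun r => g (b * r ^ 2 / 2)), ← h,
    ← integrableOn_Ioi_comp_rpow_iff' (fun t => g (b / 2 * t)) (two_ne_zero (α := ℝ))]
  refine integrableOn_congr_fun (fun r hr => ?_) measurableSet_Ioi
  simp only [finrank_euclideanSpace, Fintype.card_fin]
  rw [show (2 : ℝ) - 1 = ((1 : ℕ) : ℝ) by norm_num, Real.rpow_natCast, Real.rpow_two]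
  congr 2
  ring

theorem integral_comp_norm_sq (hb : 0 < b) (g : ℝ → ℝ) :
    ∫ x : Space 2, g (b * ‖x‖ ^ 2 / 2) = 2 * Real.pi / b * ∫ ξ in Set.Ioi 0, g ξ := by
  have hball : volume.real (Metric.ball (0 : Space 2) 1) = Real.pi := by
    rw [Measure.real, EuclideanSpace.volume_ball_fin_two]
    simp [Real.pi_pos.le]
  have h2 := integral_comp_rpow_Ioi_of_pos (g := fun t => g (b / 2 * t)) (zero_lt_two (α := ℝ))
  have h3 := integral_comp_mul_left_Ioi g 0 (show 0 < b / 2 by positivity)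
  rw [mul_zero] at h3
  rw [integral_fun_norm_addHaar volume (fun r => g (b * r ^ 2 / 2)), hball,
    finrank_euclideanSpace, Fintype.card_fin]
  have h4 : ∫ r in Set.Ioi (0 : ℝ), r ^ (2 - 1) • g (b * r ^ 2 / 2) =
      1 / 2 * ∫ r in Set.Ioi (0 : ℝ), (2 * r ^ ((2 : ℝ) - 1)) • g (b / 2 * r ^ (2 : ℝ)) := by
    rw [← integral_const_mul]
    refine setIntegral_congr_fun measurableSet_Ioi fun r hr => ?_
    rw [show (2 : ℝ) - 1 = ((1 : ℕ) : ℝ) by norm_num, Real.rpow_natCast, Real.rpow_two,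
      show b * r ^ 2 / 2 = b / 2 * r ^ 2 by ring]
    simp only [smul_eq_mul]
    ring
  rw [h4, h2, h3]
  simp only [smul_eq_mul, nsmul_eq_mul]
  push_cast
  field_simp

/-- Rotation of the plane. -/
def planeRotation (a : Circle) : Space 2 ≃ₗᵢ[ℝ] Space 2 :=
  (Complex.orthonormalBasisOneI.repr.symm.trans (rotation a)).trans
    Complex.orthonormalBasisOneI.repr

theorem coord_planeRotation (a : Circle) (x : Space 2) :
    coord (planeRotation a x) = a * coord x := by
  simp [coord_eq, planeRotation, rotation_apply]

theorem laguerreFun_planeRotation (a : Circle) (k : Index n) (x : Space 2) :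
    laguerreFun b n k (planeRotation a x) = (a : ℂ) ^ k.1 * laguerreFun b n k x := by
  simp only [laguerreFun, LinearIsometryEquiv.norm_map]
  rw [← coord, coord_planeRotation, ← coord, mul_left_comm, mul_zpow]
  ring

/-- A rotation by the angle π/(l - k) preserves the measure and multiplies the integrand by e^{iπ} =
-1, so the integral equals its own negative. No integrability is needed. -/
theorem integral_radial_mul_laguerreFun {k l : Index n} (hkl : k ≠ l) (w : ℝ → ℂ) :
    ∫ x, conj (laguerreFun b n k x) * (w ‖x‖ * laguerreFun b n l x) = 0 := by
  have hd : ((l.1 : ℝ) - k.1) ≠ 0 := by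
    rw [sub_ne_zero]
    exact fun h => hkl (Subtype.ext (by exact_mod_cast h.symm))
  set a : Circle := Circle.exp (Real.pi / ((l.1 : ℝ) - k.1))
  have ha : conj ((a : ℂ) ^ k.1) * (a : ℂ) ^ l.1 = -1 := by
    rw [map_zpow₀, ← Circle.coe_inv_eq_conj, Circle.coe_inv, inv_zpow', ← zpow_add₀ (by simp),
      Circle.coe_exp, ← Complex.exp_int_mul, ← Complex.exp_pi_mul_I]
    congr 1
    have hd' : ((l.1 : ℂ) - k.1) ≠ 0 := by exact_mod_cast hd
    push_cast
    field_simp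
    ring
  set I := ∫ x, conj (laguerreFun b n k x) * (w ‖x‖ * laguerreFun b n l x) with hI
  have h1 : I = -I := by
    conv_lhs => rw [hI, ← (planeRotation a).measurePreserving.integral_comp
      (planeRotation a).toHomeomorph.measurableEmbedding]
    rw [hI, ← integral_neg]
    congr 1
    ext x
    simp only [laguerreFun_planeRotation, LinearIsometryEquiv.norm_map, map_mul]
    linear_combination (conj (laguerreFun b n k x) * (w ‖x‖ * laguerreFun b n l x)) * ha
  have h2 : (2 : ℂ) * I = 0 := by linear_combination h1
  exact (mul_eq_zero.1 h2).resolve_left two_ne_zero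

end basis

/-! ### Uniform bounds for the radial densities -/

/-- With S = √(N+1) + |ξ - N|, each degree should cost one factor S, not N. Combining
`laguerre_succ` with `laguerre_add_one` gives (n+2)L_{n+2}^{(N)} = (n+2+N-ξ)L_{n+1}^{(N)} -
ξL_n^{(N+1)}. Its coefficients are O(S) over one degree and at most S² over two, and replacing N by
N + 1 enlarges S at most threefold. -/
theorem exists_abs_laguerre_le (n : ℕ) : ∃ C : ℝ, 0 ≤ C ∧ ∀ (N : ℕ) (ξ : ℝ), 0 ≤ ξ →
    |laguerre n N ξ| ≤ C * (√(N + 1) + |ξ - N|) ^ n := by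
  have hS1 : ∀ (N : ℕ) (ξ : ℝ), 1 + |ξ - N| ≤ √(N + 1) + |ξ - N| := fun N ξ => by
    gcongr
    rw [Real.one_le_sqrt]
    linarith [N.cast_nonneg (α := ℝ)]
  induction n using Nat.twoStepInduction with
  | zero => exact ⟨1, zero_le_one, fun N ξ _ => by simp [laguerre_zero]⟩
  | one =>
    refine ⟨1, zero_le_one, fun N ξ _ => ?_⟩
    have h := laguerre_succ 0 N ξ
    simp only [laguerre_zero, Nat.cast_zero, zero_add, one_mul, mul_one] at h
    rw [h, one_mul, pow_one]
    refine le_trans ?_ (hS1 N ξ)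
    rw [abs_sub_comm ξ, show (1 + N - ξ : ℝ) = 1 + (N - ξ) by ring]
    exact (abs_add_le _ _).trans (by rw [abs_one])
  | more n ih0 ih1 =>
    obtain ⟨C0, hC0, h0⟩ := ih0
    obtain ⟨C1, hC1, h1⟩ := ih1
    refine ⟨(n + 2) * C1 + 3 ^ n * C0, by positivity, fun N ξ hξ => ?_⟩
    have hrec := laguerre_succ (n + 1) N ξ
    rw [laguerre_add_one] at hrec
    have hN := N.cast_nonneg (α := ℝ)
    have hS := hS1 N ξ
    set S := √((N : ℝ) + 1) + |ξ - N| with hSdef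
    have ha : 0 ≤ |ξ - N| := abs_nonneg _
    have hs := Real.sq_sqrt (show 0 ≤ (N : ℝ) + 1 by positivity)
    have hs0 := Real.sqrt_nonneg ((N : ℝ) + 1)
    have hSone : 1 ≤ S := by linarith
    have hξS : ξ ≤ S ^ 2 := by
      have h2 : ξ ≤ N + |ξ - N| := by linarith [le_abs_self (ξ - N)]
      have h3 : (1 : ℝ) ≤ √((N : ℝ) + 1) := by linarith
      rw [hSdef]
      nlinarith
    have hS' : √(((N + 1 : ℕ) : ℝ) + 1) + |ξ - (N + 1 : ℕ)| ≤ 3 * S := by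
      have h2 : √(((N + 1 : ℕ) : ℝ) + 1) ≤ √((N : ℝ) + 1) + 1 := by
        rw [Real.sqrt_le_left (by positivity)]
        push_cast
        nlinarith
      have h3 : |ξ - (N + 1 : ℕ)| ≤ |ξ - N| + 1 := by
        push_cast
        rw [show ξ - (N + 1) = (ξ - N) + (-1) by ring]
        exact (abs_add_le _ _).trans (by simp)
      linarith
    have e0 : |laguerre n ((N : ℝ) + 1) ξ| ≤ C0 * (3 * S) ^ n := by
      have h2 := h0 (N + 1) ξ hξ
      rw [Nat.cast_add_one] at h2
      refine h2.trans ?_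
      rw [← Nat.cast_add_one]
      gcongr
    have e1 := h1 N ξ hξ
    have hrec' : ((n + 2 : ℝ)) * laguerre (n + 2) N ξ =
        (n + 2 + N - ξ) * laguerre (n + 1) N ξ - ξ * laguerre n (N + 1) ξ := by
      push_cast at hrec
      linear_combination hrec
    have hcoef : |(n + 2 + N - ξ : ℝ)| ≤ (n + 2) * S := by
      rw [show (n + 2 + N - ξ : ℝ) = (n + 2) + -(ξ - N) by ring]
      refine (abs_add_le _ _).trans ?_
      rw [abs_neg, abs_of_nonneg (by positivity : (0 : ℝ) ≤ n + 2)]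
      nlinarith [n.cast_nonneg (α := ℝ)]
    have hn2 : (1 : ℝ) ≤ n + 2 := by linarith [n.cast_nonneg (α := ℝ)]
    calc |laguerre (n + 2) N ξ| ≤ (n + 2) * |laguerre (n + 2) N ξ| :=
          le_mul_of_one_le_left (abs_nonneg _) hn2
      _ = |(n + 2 + N - ξ) * laguerre (n + 1) N ξ - ξ * laguerre n (N + 1) ξ| := by
          rw [← hrec', abs_mul, abs_of_nonneg (by positivity : (0 : ℝ) ≤ n + 2)]
      _ ≤ |(n + 2 + N - ξ : ℝ)| * |laguerre (n + 1) N ξ| + ξ * |laguerre n (N + 1) ξ| := by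
          refine (abs_sub _ _).trans ?_
          rw [abs_mul, abs_mul, abs_of_nonneg hξ]
      _ ≤ (n + 2) * S * (C1 * S ^ (n + 1)) + S ^ 2 * (C0 * (3 * S) ^ n) := by gcongr
      _ = _ := by rw [mul_pow]; ring

theorem integral_pow_mul_exp_neg (N : ℕ) {r : ℝ} (hr : 0 < r) :
    IntegrableOn (fun t : ℝ => t ^ N * Real.exp (-(r * t))) (Set.Ioi 0) ∧
      ∫ t in Set.Ioi (0 : ℝ), t ^ N * Real.exp (-(r * t)) = N.factorial / r ^ (N + 1) := by
  have h := Real.integral_rpow_mul_exp_neg_mul_Ioi (a := N + 1) (by positivity) hr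
  rw [add_sub_cancel_right, Real.Gamma_nat_eq_factorial] at h
  simp only [Real.rpow_natCast] at h
  have h2 : ∫ t in Set.Ioi (0 : ℝ), t ^ N * Real.exp (-(r * t)) = N.factorial / r ^ (N + 1) := by
    rw [h, ← Nat.cast_add_one, Real.rpow_natCast, one_div, inv_pow]
    ring
  refine ⟨?_, h2⟩
  -- A non-integrable function would have integral 0, contradicting the positive value just
  -- computed.
  by_contra hc
  rw [integral_undef hc] at h2
  exact absurd h2 (by positivity)

theorem integral_exp_mul_gamma_le (N : ℕ) {s : ℝ} (hs : |s| ≤ 1 / 2) :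
    IntegrableOn (fun ξ : ℝ => Real.exp (s * (ξ - N)) * (Real.exp (-ξ) * ξ ^ N)) (Set.Ioi 0) ∧
      ∫ ξ in Set.Ioi (0 : ℝ), Real.exp (s * (ξ - N)) * (Real.exp (-ξ) * ξ ^ N) ≤
        N.factorial * Real.exp (1 + 2 * (s ^ 2 * N)) := by
  have hs' := abs_le.1 hs
  have hr : 0 < 1 - s := by linarith
  obtain ⟨h1, h2⟩ := integral_pow_mul_exp_neg N hr
  have e : ∀ ξ : ℝ, Real.exp (s * (ξ - N)) * (Real.exp (-ξ) * ξ ^ N) =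
      Real.exp (-(s * N)) * (ξ ^ N * Real.exp (-((1 - s) * ξ))) := fun ξ => by
    rw [← mul_assoc, ← Real.exp_add, mul_comm (ξ ^ N), ← mul_assoc, ← Real.exp_add]
    ring_nf
  simp only [e]
  refine ⟨h1.const_mul _, ?_⟩
  rw [integral_const_mul, h2]
  -- log(1/(1-s)) ≤ 1/(1-s) - 1 ≤ s + 2s² for |s| ≤ 1/2. Raised to the power N + 1, the term sN
  -- cancels against the centring e^{-sN}, and the leftover s + 2s² is at most 1.
  have hlog : (1 - s)⁻¹ ≤ Real.exp (s + 2 * s ^ 2) := by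
    have h3 := Real.one_sub_inv_le_log_of_pos hr
    rw [← Real.exp_log (inv_pos.2 hr), Real.exp_le_exp, Real.log_inv]
    have h4 : (1 - s)⁻¹ - 1 ≤ s + 2 * s ^ 2 := by
      rw [sub_le_iff_le_add, inv_le_iff_one_le_mul₀ hr]
      nlinarith [sq_nonneg s]
    linarith
  have hpow : ((1 - s) ^ (N + 1))⁻¹ ≤ Real.exp ((N + 1 : ℕ) * (s + 2 * s ^ 2)) := by
    rw [← inv_pow, Real.exp_nat_mul]
    gcongr
  calc Real.exp (-(s * N)) * (N.factorial / (1 - s) ^ (N + 1))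
      = N.factorial * (Real.exp (-(s * N)) * ((1 - s) ^ (N + 1))⁻¹) := by ring
    _ ≤ N.factorial * (Real.exp (-(s * N)) * Real.exp ((N + 1 : ℕ) * (s + 2 * s ^ 2))) := by
        gcongr
    _ ≤ _ := by
        rw [← Real.exp_add]
        refine mul_le_mul_of_nonneg_left (Real.exp_le_exp.2 ?_) (by positivity)
        have h3 : s ^ 2 ≤ 1 / 4 := by nlinarith
        push_cast
        nlinarith

/-- A natural number as an index. -/
def natIndex (n N : ℕ) : Index n := ⟨N, by omega⟩

theorem degree_natIndex (n N : ℕ) : degree n (natIndex n N) = N + n := by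
  simp only [degree, natIndex]; omega

/-- With v = |ξ - N|/√N, the square of L_n^{(N)} is at most a constant times N^n (2 + v)^{2n}. The
power N^n is paid for by (N + n)! ≥ N! N^n, and (2 + v)^{2n} ≤ (2n)! e^{2+v}. -/
theorem exists_radialDensity_le (n : ℕ) : ∃ D : ℝ, 0 ≤ D ∧ ∀ (N : ℕ) (ξ : ℝ), 1 ≤ N → 0 ≤ ξ →
    radialDensity n (natIndex n N) ξ ≤
      D * Real.exp (|ξ - N| / √N) * (Real.exp (-ξ) * ξ ^ N) / N.factorial := by
  obtain ⟨C, hC, h⟩ := exists_abs_laguerre_le n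
  refine ⟨n.factorial * C ^ 2 * ((2 * n).factorial * Real.exp 2), by positivity,
    fun N ξ hN hξ => ?_⟩
  have hN' : (1 : ℝ) ≤ N := by exact_mod_cast hN
  have hsq := Real.sq_sqrt (show (0 : ℝ) ≤ N by positivity)
  have hs1 : 1 ≤ √(N : ℝ) := by rwa [Real.one_le_sqrt]
  have hs0 : 0 < √(N : ℝ) := by linarith
  set v := |ξ - N| / √(N : ℝ)
  have hv0 : 0 ≤ v := by positivity
  have hS : √((N : ℝ) + 1) + |ξ - N| ≤ √N * (2 + v) := by
    have h1 : √((N : ℝ) + 1) ≤ 2 * √N := by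
      rw [Real.sqrt_le_left (by positivity), mul_pow, hsq]
      linarith
    have h2 : |ξ - N| = √N * v := by simp only [v]; field_simp
    rw [h2]
    linarith
  have hL : laguerre n N ξ ^ 2 ≤ C ^ 2 * (N ^ n * ((2 * n).factorial * Real.exp (2 + v))) := by
    have h1 : |laguerre n N ξ| ≤ C * (√N * (2 + v)) ^ n :=
      (h N ξ hξ).trans (by gcongr)
    have h2 := Real.pow_div_factorial_le_exp (2 + v) (by positivity) (2 * n)
    rw [div_le_iff₀ (by positivity)] at h2
    calc laguerre n N ξ ^ 2 = |laguerre n N ξ| ^ 2 := (sq_abs _).symm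
      _ ≤ (C * (√N * (2 + v)) ^ n) ^ 2 := by gcongr
      _ = C ^ 2 * ((√N ^ 2) ^ n * (2 + v) ^ (2 * n)) := by
          rw [mul_pow, mul_pow, mul_pow, ← pow_mul, ← pow_mul, ← pow_mul, mul_comm n 2]
      _ ≤ _ := by
          rw [hsq, mul_comm (((2 * n).factorial : ℝ))]
          gcongr
  have hfac : (N.factorial * N ^ n : ℝ) ≤ (N + n).factorial := by
    have h1 := Nat.factorial_mul_pow_le_factorial (m := N) (n := n)
    refine le_trans ?_ (by exact_mod_cast h1 : (N.factorial * (N + 1) ^ n : ℝ) ≤ (N + n).factorial)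
    gcongr
    linarith
  have hk : ((natIndex n N).1 : ℝ) = N := by simp [natIndex]
  have hz : ξ ^ (natIndex n N).1 = ξ ^ N := by simp [natIndex]
  rw [radialDensity, factorialRatio_eq, degree_natIndex, hk, hz]
  calc _ ≤ (n.factorial : ℝ) / (N.factorial * N ^ n) * (Real.exp (-ξ) * ξ ^ N *
        (C ^ 2 * (N ^ n * ((2 * n).factorial * Real.exp (2 + v))))) := by gcongr
    _ = _ := by rw [Real.exp_add]; field_simp

theorem exists_integral_radialDensity_le (n : ℕ) {c : ℝ} (hc : 0 ≤ c) : ∃ (C : ℝ) (N₀ : ℕ), 0 ≤ C ∧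
    1 ≤ N₀ ∧ ∀ (N : ℕ), N₀ ≤ N → ∀ w : ℝ → ℝ,
      IntegrableOn (fun ξ => w ξ * radialDensity n (natIndex n N) ξ) (Set.Ioi 0) →
      (∀ ξ, 0 < ξ → w ξ ≤ Real.exp (c * (|ξ - N| / √N))) →
      ∫ ξ in Set.Ioi 0, w ξ * radialDensity n (natIndex n N) ξ ≤ C := by
  obtain ⟨D, hD, h⟩ := exists_radialDensity_le n
  -- In s = (c + 1)/√N, c comes from the weight and 1 from `exists_radialDensity_le`. Then s²N = (c
  -- + 1)² is free of N, the threshold ensures s ≤ 1/2, and the factor 2 stems from e^{s|t|} ≤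
  -- e^{st} + e^{-st}.
  refine ⟨D * (2 * Real.exp (1 + 2 * (c + 1) ^ 2)), ⌈4 * (c + 1) ^ 2⌉₊ + 1, by positivity,
    by omega, fun N hN w hw hwc => ?_⟩
  have hN1 : 1 ≤ N := by omega
  have hNc : 4 * (c + 1) ^ 2 ≤ N :=
    (Nat.le_ceil _).trans (by exact_mod_cast (by omega : ⌈4 * (c + 1) ^ 2⌉₊ ≤ N))
  have hN' : (1 : ℝ) ≤ N := by exact_mod_cast hN1
  have hsq := Real.sq_sqrt (show (0 : ℝ) ≤ N by positivity)
  have hs0 : 0 < √(N : ℝ) := by positivity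
  set s := (c + 1) / √(N : ℝ) with hs
  have hsN : s ^ 2 * N = (c + 1) ^ 2 := by rw [hs, div_pow, hsq]; field_simp
  have hs_nonneg : 0 ≤ s := by positivity
  have hs2 : s ≤ 1 / 2 := by
    rw [hs, div_le_iff₀ hs0]
    have h1 : 2 * (c + 1) ≤ √(N : ℝ) := by
      rw [Real.le_sqrt' (by positivity)]; linarith
    linarith
  obtain ⟨i1, b1⟩ := integral_exp_mul_gamma_le N (s := s) (by rwa [abs_of_nonneg hs_nonneg])
  obtain ⟨i2, b2⟩ := integral_exp_mul_gamma_le N (s := -s)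
    (by rwa [abs_neg, abs_of_nonneg hs_nonneg])
  rw [neg_sq, hsN] at b2
  rw [hsN] at b1
  have hle : ∀ ξ ∈ Set.Ioi (0 : ℝ), w ξ * radialDensity n (natIndex n N) ξ ≤
      D / N.factorial * (Real.exp (s * (ξ - N)) * (Real.exp (-ξ) * ξ ^ N) +
        Real.exp (-s * (ξ - N)) * (Real.exp (-ξ) * ξ ^ N)) := fun ξ hξ => by
    have hξ' : 0 < ξ := hξ
    have hr : 0 ≤ radialDensity n (natIndex n N) ξ := by
      have := factorialRatio_pos n (natIndex n N)
      unfold radialDensity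
      positivity
    have hexp : Real.exp (c * (|ξ - N| / √N)) * Real.exp (|ξ - N| / √N) ≤
        Real.exp (s * (ξ - N)) + Real.exp (-s * (ξ - N)) := by
      rw [← Real.exp_add, show c * (|ξ - N| / √N) + |ξ - N| / √N = s * |ξ - N| by
        rw [hs]; ring]
      rcases abs_cases (ξ - (N : ℝ)) with ⟨h1, _⟩ | ⟨h1, _⟩
      · rw [h1]; exact le_add_of_nonneg_right (Real.exp_pos _).le
      · rw [h1, mul_neg, ← neg_mul]; exact le_add_of_nonneg_left (Real.exp_pos _).le
    calc _ ≤ Real.exp (c * (|ξ - N| / √N)) * (D * Real.exp (|ξ - N| / √N) *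
          (Real.exp (-ξ) * ξ ^ N) / N.factorial) :=
          mul_le_mul (hwc ξ hξ') (h N ξ hN1 hξ'.le) hr (Real.exp_pos _).le
      _ = D / N.factorial * ((Real.exp (c * (|ξ - N| / √N)) * Real.exp (|ξ - N| / √N)) *
          (Real.exp (-ξ) * ξ ^ N)) := by ring
      _ ≤ D / N.factorial * ((Real.exp (s * (ξ - N)) + Real.exp (-s * (ξ - N))) *
          (Real.exp (-ξ) * ξ ^ N)) := by gcongr
      _ = _ := by ring
  calc _ ≤ ∫ ξ in Set.Ioi (0 : ℝ), D / N.factorial *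
        (Real.exp (s * (ξ - N)) * (Real.exp (-ξ) * ξ ^ N) +
        Real.exp (-s * (ξ - N)) * (Real.exp (-ξ) * ξ ^ N)) :=
        setIntegral_mono_on hw ((i1.add i2).const_mul _) measurableSet_Ioi hle
    _ = D / N.factorial * ((∫ ξ in Set.Ioi (0 : ℝ), Real.exp (s * (ξ - N)) *
        (Real.exp (-ξ) * ξ ^ N)) + ∫ ξ in Set.Ioi (0 : ℝ),
        Real.exp (-s * (ξ - N)) * (Real.exp (-ξ) * ξ ^ N)) := by
        rw [integral_const_mul, integral_add i1 i2]
    _ ≤ D / N.factorial * (N.factorial * Real.exp (1 + 2 * (c + 1) ^ 2) +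
        N.factorial * Real.exp (1 + 2 * (c + 1) ^ 2)) := by gcongr
    _ = _ := by field_simp; ring

/-! ### Exponential moments of the Laguerre functions -/

section moments

variable {b : ℝ} (n : ℕ)

theorem bracket_norm (x : Space 2) : bracket ‖x‖ = bracket x := by simp [bracket]

theorem one_le_bracket {E : Type*} [Norm E] (x : E) : 1 ≤ bracket x := by
  rw [bracket, Real.one_le_sqrt]
  linarith [sq_nonneg ‖x‖]

theorem bracket_le {E : Type*} [SeminormedAddGroup E] (x : E) : bracket x ≤ 1 + ‖x‖ := by
  rw [bracket, Real.sqrt_le_left (by positivity)]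
  nlinarith [norm_nonneg x]

theorem norm_le_bracket {E : Type*} [SeminormedAddGroup E] (x : E) : ‖x‖ ≤ bracket x :=
  Real.le_sqrt_of_sq_le (by linarith)

theorem abs_bracket_sub_le (s t : ℝ) : |bracket s - bracket t| ≤ |s - t| := by
  have h : ∀ s t : ℝ, bracket s ≤ bracket t + |s - t| := fun s t => by
    have h0 := Real.sqrt_nonneg (1 + |t| ^ 2)
    have h2 : |t| ≤ √(1 + |t| ^ 2) := norm_le_bracket t
    rw [bracket, bracket, Real.sqrt_le_left (by positivity)]
    simp only [Real.norm_eq_abs]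
    have h1 := Real.sq_sqrt (show 0 ≤ 1 + |t| ^ 2 by positivity)
    have h3 : |s| ≤ |t| + |s - t| := by
      have := abs_add_le t (s - t)
      rwa [add_sub_cancel] at this
    have h4 : |s| ^ 2 ≤ (|t| + |s - t|) ^ 2 := by gcongr
    nlinarith [abs_nonneg (s - t)]
  rw [abs_le]
  constructor
  · linarith [h t s, abs_sub_comm s t]
  · linarith [h s t]

theorem expGrowth_exp_bracket (c : ℝ) :
    ExpGrowth fun x : Space 2 => ((Real.exp (c * bracket x) : ℝ) : ℂ) := by
  refine ⟨Real.exp |c|, |c|, fun x => ?_⟩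
  rw [Complex.norm_real, Real.norm_eq_abs, Real.abs_exp, ← Real.exp_add, Real.exp_le_exp]
  calc c * bracket x ≤ |c| * bracket x := by
        gcongr
        · linarith [one_le_bracket x]
        · exact le_abs_self c
    _ ≤ |c| * (1 + ‖x‖) := by gcongr; exact bracket_le x
    _ = _ := by ring

theorem continuous_exp_bracket (c : ℝ) :
    Continuous fun x : Space 2 => ((Real.exp (c * bracket x) : ℝ) : ℂ) := by
  have h : Continuous (bracket : Space 2 → ℝ) := continuous_bracket
  fun_prop

theorem memLp_exp_bracket_mul_laguerreFun (hb : 0 < b) (k : Index n) (c : ℝ) :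
    MemLp (fun x => ((Real.exp (c * bracket x) : ℝ) : ℂ) * laguerreFun b n k x) 2 volume := by
  have h1 : MemLp (fun x => wave b 0 ((raise b ^ n) (MvPolynomial.X 0 ^ degree n k)) x *
      ((Real.exp (c * bracket x) : ℝ) : ℂ)) 2 volume :=
    ((decays_wave hb _).mul_expGrowth (expGrowth_exp_bracket c)).memLp_two
      ((continuous_wave _).mul (continuous_exp_bracket c)).aestronglyMeasurable
  refine (h1.const_mul (waveCoeff b n k : ℂ)).ae_eq ?_
  filter_upwards [Measure.ae_ne volume (0 : Space 2)] with x hx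
  rw [laguerreFun_eq n k hx]
  ring

theorem integrable_exp_bracket_mul_laguerreFun (hb : 0 < b) (k : Index n) (c : ℝ) :
    Integrable fun x => Real.exp (c * bracket x) * ‖laguerreFun b n k x‖ ^ 2 := by
  have h := memLp_exp_bracket_mul_laguerreFun n hb k (c / 2)
  rw [memLp_two_iff_integrable_sq_norm h.aestronglyMeasurable] at h
  refine h.congr (Eventually.of_forall fun x => ?_)
  dsimp only
  rw [norm_mul, mul_pow, Complex.norm_real, Real.norm_eq_abs, sq_abs, ← Real.exp_nat_mul]
  congr 2
  push_cast
  ring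

/-- The moment `∫ e^{c⟨x⟩} |φ_{n,k}|²`. -/
def expMoment (b : ℝ) (n : ℕ) (c : ℝ) (k : Index n) : ℝ :=
  ∫ x, Real.exp (c * bracket x) * ‖laguerreFun b n k x‖ ^ 2

/-- The integrand of the moment `∫ e^{c⟨x⟩} |φ_{n,k}|²`, in the variable `ξ = b‖x‖²/2`. -/
def momentDensity (b : ℝ) (n : ℕ) (c : ℝ) (k : Index n) (ξ : ℝ) : ℝ :=
  b / (2 * Real.pi) * (Real.exp (c * bracket √(2 * ξ / b)) * radialDensity n k ξ)

theorem exp_bracket_mul_laguerreFun_eq (hb : 0 < b) (k : Index n) (c : ℝ) (x : Space 2) :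
    Real.exp (c * bracket x) * ‖laguerreFun b n k x‖ ^ 2 =
      momentDensity b n c k (b * ‖x‖ ^ 2 / 2) := by
  have h : √(2 * (b * ‖x‖ ^ 2 / 2) / b) = ‖x‖ := by
    rw [show 2 * (b * ‖x‖ ^ 2 / 2) / b = ‖x‖ ^ 2 by field_simp, Real.sqrt_sq (norm_nonneg x)]
  rw [momentDensity, norm_laguerreFun_sq n hb, h, bracket_norm]
  ring

theorem integrableOn_exp_bracket_mul_radialDensity (hb : 0 < b) (k : Index n) (c : ℝ) :
    IntegrableOn (fun ξ => Real.exp (c * bracket √(2 * ξ / b)) * radialDensity n k ξ)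
      (Set.Ioi 0) := by
  have h := (integrable_comp_norm_sq hb (g := momentDensity b n c k)).1
    ((integrable_exp_bracket_mul_laguerreFun n hb k c).congr
      (Eventually.of_forall (exp_bracket_mul_laguerreFun_eq n hb k c)))
  have h2 := h.const_mul (b / (2 * Real.pi))⁻¹
  simp only [momentDensity, ← mul_assoc,
    inv_mul_cancel₀ (show b / (2 * Real.pi) ≠ 0 by positivity), one_mul] at h2
  exact h2

theorem expMoment_eq (hb : 0 < b) (k : Index n) (c : ℝ) :
    expMoment b n c k = ∫ ξ in Set.Ioi 0, Real.exp (c * bracket √(2 * ξ / b)) *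
      radialDensity n k ξ := by
  rw [expMoment, integral_congr_ae (Eventually.of_forall (exp_bracket_mul_laguerreFun_eq n hb k c)),
    integral_comp_norm_sq hb]
  simp only [momentDensity]
  rw [integral_const_mul, ← mul_assoc]
  field_simp

theorem factorialRatio_mul_eigenIntegrand (q : ℝ) (k : Index n) (ξ : ℝ) :
    factorialRatio n k * eigenIntegrand b q n k ξ =
      Real.exp (-q * bracket √(2 * ξ / b)) * radialDensity n k ξ := by
  rw [eigenIntegrand, radialDensity]; ring

theorem integrableOn_eigenIntegrand (hb : 0 < b) (q : ℝ) (k : Index n) :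
    IntegrableOn (eigenIntegrand b q n k) (Set.Ioi 0) := by
  have h := (integrableOn_exp_bracket_mul_radialDensity n hb k (-q)).const_mul
    (factorialRatio n k)⁻¹
  simp only [← factorialRatio_mul_eigenIntegrand, ← mul_assoc,
    inv_mul_cancel₀ (factorialRatio_pos n k).ne', one_mul] at h
  exact h

theorem eigenvalue_eq_expMoment (hb : 0 < b) (q : ℝ) (k : Index n) :
    eigenvalue b q n k = expMoment b n (-q) k := by
  rw [expMoment_eq n hb, eigenvalue, ← integral_const_mul]
  simp only [factorialRatio_mul_eigenIntegrand]

theorem expMoment_nonneg (c : ℝ) (k : Index n) : 0 ≤ expMoment b n c k :=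
  integral_nonneg fun x => by positivity

theorem abs_sqrt_sub_sqrt_le {ξ η : ℝ} (hξ : 0 ≤ ξ) (hη : 0 < η) :
    |√ξ - √η| ≤ |ξ - η| / √η := by
  have h1 : 0 < √η := Real.sqrt_pos.2 hη
  rw [le_div_iff₀ h1]
  have h2 : ξ - η = (√ξ - √η) * (√ξ + √η) := by
    linear_combination -Real.sq_sqrt hξ + Real.sq_sqrt hη.le
  rw [h2, abs_mul, abs_of_nonneg (by positivity : 0 ≤ √ξ + √η)]
  gcongr
  linarith [Real.sqrt_nonneg ξ]

/-- The bracket is 1-Lipschitz and |√ξ - √N| ≤ |ξ - N|/√N. Replacing ⟨√(2ξ/b)⟩ by ⟨√(2N/b)⟩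
therefore costs a weight of the admissible form with c = q√(2/b). -/
theorem exists_expMoment_le (hb : 0 < b) {q : ℝ} (hq : 0 < q) : ∃ (C : ℝ) (N₀ : ℕ), 0 ≤ C ∧
    ∀ N : ℕ, N₀ ≤ N →
      expMoment b n q (natIndex n N) ≤ Real.exp (q * bracket √(2 * N / b)) * C ∧
      expMoment b n (-q) (natIndex n N) ≤ Real.exp (-q * bracket √(2 * N / b)) * C := by
  have hc0 : 0 ≤ q * √(2 / b) := by positivity
  obtain ⟨C, N₀, hC, hN₀, h⟩ := exists_integral_radialDensity_le n hc0
  refine ⟨C, N₀, hC, fun N hN => ?_⟩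
  have hNpos : (0 : ℝ) < N := by exact_mod_cast (by omega : 0 < N)
  have key : ∀ ξ : ℝ, 0 < ξ → q * |bracket √(2 * ξ / b) - bracket √(2 * N / b)| ≤
      q * √(2 / b) * (|ξ - N| / √N) := fun ξ hξ => by
    rw [mul_assoc]
    gcongr
    refine (abs_bracket_sub_le _ _).trans ?_
    rw [mul_div_right_comm, mul_div_right_comm, Real.sqrt_mul (by positivity),
      Real.sqrt_mul (by positivity), ← mul_sub, abs_mul, abs_of_nonneg (Real.sqrt_nonneg _)]
    gcongr
    exact abs_sqrt_sub_sqrt_le hξ.le hNpos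
  have main : ∀ σ : ℝ, (σ = q ∨ σ = -q) → expMoment b n σ (natIndex n N) ≤
      Real.exp (σ * bracket √(2 * N / b)) * C := fun σ hσ => by
    have hw : IntegrableOn (fun ξ => Real.exp (σ * (bracket √(2 * ξ / b) - bracket √(2 * N / b))) *
        radialDensity n (natIndex n N) ξ) (Set.Ioi 0) := by
      refine ((integrableOn_exp_bracket_mul_radialDensity n hb (natIndex n N) σ).const_mul
        (Real.exp (-(σ * bracket √(2 * N / b))))).congr (Eventually.of_forall fun ξ => ?_)
      dsimp only
      rw [← mul_assoc, ← Real.exp_add]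
      congr 2
      ring
    have h1 := h N hN _ hw fun ξ hξ => by
      rw [Real.exp_le_exp]
      refine le_trans ?_ (key ξ hξ)
      rcases hσ with rfl | rfl
      · gcongr; exact le_abs_self _
      · rw [neg_mul, ← mul_neg]; gcongr; exact neg_le_abs _
    rw [expMoment_eq n hb]
    calc _ = Real.exp (σ * bracket √(2 * N / b)) * ∫ ξ in Set.Ioi 0,
          Real.exp (σ * (bracket √(2 * ξ / b) - bracket √(2 * N / b))) *
          radialDensity n (natIndex n N) ξ := by
          rw [← integral_const_mul]
          congr 1
          ext ξ
          rw [← mul_assoc, ← Real.exp_add]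
          congr 2
          ring
      _ ≤ _ := by gcongr
  exact ⟨main q (Or.inl rfl), main (-q) (Or.inr rfl)⟩

theorem finite_index_lt (m : ℤ) : {k : Index n | k.1 < m}.Finite := by
  refine Set.Finite.preimage (f := fun k : Index n => k.1) Subtype.val_injective.injOn
    (Set.finite_Ico (-(n : ℤ)) m) |>.subset fun k hk => ?_
  exact ⟨k.2, hk⟩

theorem exists_natIndex_eq {k : Index n} (hk : 0 ≤ k.1) : ∃ N : ℕ, k = natIndex n N ∧ k.1 = N := by
  obtain ⟨N, hN⟩ := Int.eq_ofNat_of_zero_le hk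
  exact ⟨N, Subtype.ext hN, hN⟩

/-- The exponential moments of rates `q` and `-q` balance, uniformly in `k`. -/
theorem exists_expMoment_mul_le (hb : 0 < b) {q : ℝ} (hq : 0 < q) :
    ∃ M : ℝ, ∀ k, expMoment b n (-q) k * expMoment b n q k ≤ M := by
  obtain ⟨C, N₀, hC, h⟩ := exists_expMoment_le n hb hq
  have hfin := (finite_index_lt n N₀).image fun k => expMoment b n (-q) k * expMoment b n q k
  obtain ⟨M, hM⟩ := hfin.bddAbove
  -- Only finitely many indices k lie below `N₀`; for the others the two exponential factors cancel.
  refine ⟨max M (C * C), fun k => ?_⟩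
  rcases lt_or_ge k.1 N₀ with hk | hk
  · exact (hM ⟨k, hk, rfl⟩).trans (le_max_left _ _)
  · obtain ⟨N, rfl, hN⟩ := exists_natIndex_eq n (le_trans (by positivity) hk)
    obtain ⟨h1, h2⟩ := h N (by rw [hN] at hk; exact_mod_cast hk)
    refine le_trans ?_ (le_max_right _ _)
    calc _ ≤ (Real.exp (-q * bracket √(2 * N / b)) * C) *
          (Real.exp (q * bracket √(2 * N / b)) * C) :=
          mul_le_mul h2 h1 (expMoment_nonneg n _ _) (by positivity)
      _ = Real.exp (-q * bracket √(2 * N / b) + q * bracket √(2 * N / b)) * (C * C) := by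
          rw [Real.exp_add]; ring
      _ = C * C := by rw [neg_mul, neg_add_cancel, Real.exp_zero, one_mul]

theorem tendsto_expMoment_neg (hb : 0 < b) {q : ℝ} (hq : 0 < q) :
    Tendsto (expMoment b n (-q)) cofinite (𝓝 0) := by
  obtain ⟨C, N₀, hC, h⟩ := exists_expMoment_le n hb hq
  have hk : Tendsto (fun k : Index n => (k.1 : ℝ)) cofinite atTop := by
    refine tendsto_intCast_atTop_atTop.comp (tendsto_atTop.2 fun m => ?_)
    rw [eventually_cofinite]
    simpa only [not_le] using finite_index_lt n m
  have hlim : Tendsto (fun k : Index n => Real.exp (-(q * √(2 * k.1 / b))) * C) cofinite (𝓝 0) := by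
    rw [← zero_mul C]
    refine (Real.tendsto_exp_neg_atTop_nhds_zero.comp ?_).mul_const C
    refine Tendsto.const_mul_atTop hq (Real.tendsto_sqrt_atTop.comp ?_)
    exact (hk.const_mul_atTop two_pos).atTop_div_const hb
  refine squeeze_zero' (Eventually.of_forall fun k => expMoment_nonneg n _ _) ?_ hlim
  have hev : ∀ᶠ k : Index n in cofinite, (N₀ : ℤ) ≤ k.1 := by
    rw [eventually_cofinite]
    simpa only [not_le] using finite_index_lt n N₀
  filter_upwards [hev] with k hk
  obtain ⟨N, rfl, hN⟩ := exists_natIndex_eq n (le_trans (by positivity) hk)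
  refine (h N (by rw [hN] at hk; exact_mod_cast hk)).2.trans ?_
  rw [hN, neg_mul]
  push_cast
  gcongr
  exact (Real.le_norm_self _).trans (norm_le_bracket _)

end moments

/-! ### Listing the eigenvalues in decreasing order -/

/-- Rank each index by the number of indices with a strictly larger value, finite because f tends to
0. Indices have equal rank exactly when their values agree, so ranks have finite fibres and infinite
range. Enumerating that range in increasing order lists the distinct values in decreasing order. -/
theorem exists_decreasing_listing {ι : Type*} [Infinite ι] {f : ι → ℝ} (hpos : ∀ k, 0 < f k)
    (hlim : Tendsto f cofinite (𝓝 0)) :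
    ∃ (lam : ℕ → ℝ) (m : ℕ → ℕ) (e : (Σ i : ℕ, Fin (m i)) ≃ ι), (∀ i, 0 < m i) ∧
      StrictAnti lam ∧ Tendsto lam atTop (𝓝 0) ∧ ∀ p, f (e p) = lam p.1 := by
  have hfin : ∀ ε > 0, {k | ε ≤ f k}.Finite := fun ε hε => by
    have h := (hlim.eventually (gt_mem_nhds hε))
    rw [eventually_cofinite] at h
    simpa only [not_lt] using h
  have hfin' : ∀ k, {l | f k < f l}.Finite := fun k =>
    (hfin _ (hpos k)).subset fun l (hl : f k < f l) => hl.le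
  let r : ι → ℕ := fun k => {l | f k < f l}.ncard
  have hr : ∀ k l, f k < f l → r l < r k := fun k l h => by
    refine Set.ncard_lt_ncard ?_ (hfin' k)
    refine ⟨fun j (hj : f l < f j) => h.trans hj, fun hsub => ?_⟩
    exact lt_irrefl _ (show f l < f l from hsub h)
  have hr' : ∀ k l, r k = r l → f k = f l := fun k l h => by
    rcases lt_trichotomy (f k) (f l) with h1 | h1 | h1
    · exact absurd (hr _ _ h1) (by omega)
    · exact h1
    · exact absurd (hr _ _ h1) (by omega)
  have hfib : ∀ i, (r ⁻¹' {i}).Finite := fun i => by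
    rcases (r ⁻¹' {i}).eq_empty_or_nonempty with h | ⟨k, hk⟩
    · rw [h]; exact Set.finite_empty
    · exact (hfin _ (hpos k)).subset fun l hl => (hr' k l (hk.trans hl.symm)).le
  have hinf : (Set.range r).Infinite := fun h => by
    have h1 := h.preimage' fun i _ => hfib i
    rw [Set.preimage_range] at h1
    exact Set.infinite_univ h1
  have : Infinite (Set.range r) := hinf.to_subtype
  classical
  let iso : ℕ ≃o Set.range r := Nat.Subtype.orderIsoOfNat _
  choose c hc using fun i => (iso i).2
  let idx : ι → ℕ := fun k => iso.symm ⟨r k, k, rfl⟩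
  have hidx : ∀ k, r (c (idx k)) = r k := fun k => by simp [hc, idx]
  have hidxc : ∀ i, idx (c i) = i := fun i => by
    simp only [idx]
    rw [OrderIso.symm_apply_eq]
    exact Subtype.ext (hc i)
  have hfibi : ∀ i, Finite {k // idx k = i} := fun i => by
    refine Set.Finite.to_subtype ((hfib (iso i)).subset fun k (hk : idx k = i) => ?_)
    rw [Set.mem_preimage, Set.mem_singleton_iff, ← hk, ← hidx, hc]
  refine ⟨fun i => f (c i), fun i => Nat.card {k // idx k = i},
    (Equiv.sigmaCongrRight fun i => (Finite.equivFin {k // idx k = i}).symm).trans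
      (Equiv.sigmaFiberEquiv idx), fun i => ?_, fun i j hij => ?_, ?_, fun p => ?_⟩
  · have : Nonempty {k // idx k = i} := ⟨c i, hidxc i⟩
    exact Nat.card_pos
  · by_contra hcon
    have h1 : r (c i) < r (c j) := by
      rw [hc, hc]; exact iso.lt_iff_lt.2 hij
    rcases lt_or_eq_of_le (not_lt.1 hcon) with h2 | h2
    · exact absurd (hr _ _ h2) (by omega)
    · simp only [r, h2] at h1
      exact lt_irrefl _ h1
  · have hinj : Function.Injective c := Function.LeftInverse.injective hidxc
    rw [← Nat.cofinite_eq_atTop]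
    exact hlim.comp hinj.tendsto_cofinite
  · set k := (Finite.equivFin {k // idx k = p.1}).symm p.2 with hk
    have h1 : f k.1 = f (c p.1) := hr' _ _ (by rw [← hidx, k.2])
    exact h1

/-! ### The eigenvalues of the sandwiched multiplication operator -/

section eigenvalues

variable {b : ℝ} (hb : 0 < b) (n : ℕ)

instance : Infinite (Index n) := Infinite.of_injective (natIndex n) fun N M h => by
  have := congrArg Subtype.val h
  simpa [natIndex] using this

theorem integral_conj_mul_weight (k : Index n) (c : ℝ) :
    ∫ x, conj (laguerreFun b n k x) * ((Real.exp (c * bracket x) : ℂ) * laguerreFun b n k x) =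
      (expMoment b n c k : ℂ) := by
  rw [expMoment, ← integral_complex_ofReal]
  congr 1
  ext x
  have h : conj (laguerreFun b n k x) * laguerreFun b n k x = (‖laguerreFun b n k x‖ : ℂ) ^ 2 := by
    rw [mul_comm, Complex.mul_conj, Complex.normSq_eq_norm_sq]; push_cast; rfl
  push_cast
  linear_combination Complex.exp (c * bracket x) * h

theorem expMoment_zero (hb : 0 < b) (k : Index n) : expMoment b n 0 k = 1 := by
  have h1 := inner_eq_integral (coeFn_laguerreLp hb n k) (coeFn_laguerreLp hb n k)
  have h2 := integral_conj_mul_weight (b := b) n k 0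
  simp only [zero_mul, Real.exp_zero, Complex.ofReal_one, one_mul] at h2
  rw [h2, inner_self_eq_norm_sq_to_K, (orthonormal_laguerreLp hb n).1 k] at h1
  have h3 : (1 : ℂ) = (expMoment b n 0 k : ℂ) := by simpa using h1
  exact_mod_cast h3.symm

theorem expMoment_pos (hb : 0 < b) (c : ℝ) (k : Index n) : 0 < expMoment b n c k := by
  refine lt_of_le_of_ne (expMoment_nonneg n c k) fun h => ?_
  have h1 := (integral_eq_zero_iff_of_nonneg (fun x => by positivity)
    (integrable_exp_bracket_mul_laguerreFun n hb k c)).1 h.symm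
  have h2 : expMoment b n 0 k = 0 := by
    refine integral_eq_zero_of_ae ?_
    filter_upwards [h1] with x hx
    have h3 := (mul_eq_zero.1 hx).resolve_left (Real.exp_pos _).ne'
    rw [h3, mul_zero, Pi.zero_apply]
  rw [expMoment_zero n hb] at h2
  exact one_ne_zero h2

/-- Since ⟨x⟩ ≥ 1 and φ_{n,k} is normalized. The bound guarantees that the radicand in `locRadius`
is nonnegative, so that ⟨r⟩ = -ln(λ)/q holds. -/
theorem expMoment_neg_le (hb : 0 < b) {q : ℝ} (hq : 0 < q) (k : Index n) :
    expMoment b n (-q) k ≤ Real.exp (-q) := by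
  have h : expMoment b n (-q) k ≤ Real.exp (-q) * expMoment b n 0 k := by
    rw [expMoment, expMoment, ← integral_const_mul]
    refine integral_mono (integrable_exp_bracket_mul_laguerreFun n hb k _)
      ((integrable_exp_bracket_mul_laguerreFun n hb k 0).const_mul _) fun x => ?_
    dsimp only
    rw [zero_mul, Real.exp_zero, one_mul]
    gcongr
    nlinarith [one_le_bracket x]
  rwa [expMoment_zero n hb, mul_one] at h

theorem inner_expMul_laguerreLp {q : ℝ} (hq : 0 < q) (k l : Index n) :
    ⟪laguerreLp hb n l, expMul q hq (laguerreLp hb n k)⟫_ℂ =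
      (eigenvalue b q n k : ℂ) * ⟪laguerreLp hb n l, laguerreLp hb n k⟫_ℂ := by
  classical
  have h1 : (expMul q hq (laguerreLp hb n k) : Space 2 → ℂ) =ᵐ[volume]
      fun x => (Real.exp (-q * bracket x) : ℂ) * laguerreFun b n k x := by
    filter_upwards [coeFn_expMul hq (laguerreLp hb n k), coeFn_laguerreLp hb n k] with x h2 h3
    rw [h2, h3]
  rw [inner_eq_integral (coeFn_laguerreLp hb n l) h1,
    orthonormal_iff_ite.1 (orthonormal_laguerreLp hb n) l k]
  by_cases hlk : l = k
  · subst hlk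
    rw [integral_conj_mul_weight, if_pos rfl, mul_one, eigenvalue_eq_expMoment n hb]
  · rw [if_neg hlk, mul_zero]
    have h2 := integral_radial_mul_laguerreFun (b := b) n hlk
      fun r => (Real.exp (-q * bracket r) : ℂ)
    simpa only [bracket_norm] using h2

theorem sandwich_laguerreLp {q : ℝ} (hq : 0 < q) (k : Index n) :
    sandwich q hq (levelProj b n) (laguerreLp hb n k) =
      (eigenvalue b q n k : ℂ) • laguerreLp hb n k := by
  have hself : ∀ l, levelProj b n (laguerreLp hb n l) = laguerreLp hb n l := fun l =>
    Submodule.starProjection_eq_self_iff.2 (laguerreLp_mem_level hb n l)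
  have h1 : sandwich q hq (levelProj b n) (laguerreLp hb n k) =
      levelProj b n (expMul q hq (laguerreLp hb n k)) := by
    simp [sandwich, hself]
  rw [h1, ← sub_eq_zero]
  -- The difference lies in the level, so it is enough to test it against the basis, where P_n can
  -- be moved to the left and disappears.
  refine eq_zero_of_mem_level_of_inner_laguerreLp hb n (Submodule.sub_mem _
    (Submodule.starProjection_apply_mem _ _)
    (Submodule.smul_mem _ _ (laguerreLp_mem_level hb n k))) fun l => ?_
  rw [inner_sub_right, inner_smul_right, levelProj,
    ← Submodule.inner_starProjection_left_eq_right, ← levelProj, hself,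
    inner_expMul_laguerreLp, sub_self]

theorem bracket_locRadius {q lam : ℝ} (hq : 0 < q) (h0 : 0 < lam) (h1 : lam ≤ Real.exp (-q)) :
    bracket (locRadius q lam) = -Real.log lam / q := by
  have hlog : Real.log lam ≤ -q := (Real.log_le_iff_le_exp h0).2 h1
  have h2 : 1 ≤ -Real.log lam / q := by rw [le_div_iff₀ hq]; linarith
  have h3 : 0 ≤ (Real.log lam / q) ^ 2 - 1 := by
    have h4 : (Real.log lam / q) ^ 2 = (-Real.log lam / q) ^ 2 := by rw [neg_div, neg_sq]
    rw [h4]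
    nlinarith
  rw [bracket, locRadius, Real.norm_eq_abs, sq_abs, Real.sq_sqrt h3, add_sub_cancel,
    show Real.log lam / q = -(-Real.log lam / q) by ring, neg_sq, Real.sqrt_sq (by linarith)]

/-- Bounding e^{q|t|} by e^{qt} + e^{-qt} with t = ⟨x⟩ - ⟨r⟩ and using e^{q⟨r⟩} = 1/λ, the first
term integrates to λ times the moment of rate q, at most M, and the second to λ⁻¹λ = 1. -/
theorem lintegral_localization_le (hb : 0 < b) {q : ℝ} (hq : 0 < q) (k : Index n) {M : ℝ}
    (hM : expMoment b n (-q) k * expMoment b n q k ≤ M) :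
    ∫⁻ x, ENNReal.ofReal
      (Real.exp (q * |bracket x - bracket (locRadius q (expMoment b n (-q) k))|) *
        ‖laguerreFun b n k x‖ ^ 2)
      ≤ ENNReal.ofReal (M + 1) := by
  set lam := expMoment b n (-q) k with hlam
  have hpos : 0 < lam := expMoment_pos n hb _ k
  have hr := bracket_locRadius hq hpos (expMoment_neg_le n hb hq k)
  have hexp : Real.exp (q * bracket (locRadius q lam)) = lam⁻¹ := by
    rw [hr, mul_div_cancel₀ _ hq.ne', Real.exp_neg, Real.exp_log hpos]
  have hi : Integrable fun x => lam * (Real.exp (q * bracket x) * ‖laguerreFun b n k x‖ ^ 2) +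
      lam⁻¹ * (Real.exp (-q * bracket x) * ‖laguerreFun b n k x‖ ^ 2) :=
    ((integrable_exp_bracket_mul_laguerreFun n hb k q).const_mul lam).add
    ((integrable_exp_bracket_mul_laguerreFun n hb k (-q)).const_mul lam⁻¹)
  have hle : ∀ x, Real.exp (q * |bracket x - bracket (locRadius q lam)|) *
      ‖laguerreFun b n k x‖ ^ 2 ≤ lam * (Real.exp (q * bracket x) * ‖laguerreFun b n k x‖ ^ 2) +
      lam⁻¹ * (Real.exp (-q * bracket x) * ‖laguerreFun b n k x‖ ^ 2) := fun x => by
    rw [← mul_assoc, ← mul_assoc, ← add_mul]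
    gcongr
    have e1 : Real.exp (q * (bracket x - bracket (locRadius q lam))) =
        lam * Real.exp (q * bracket x) := by
      rw [mul_sub, Real.exp_sub, hexp, div_inv_eq_mul, mul_comm]
    have e2 : Real.exp (q * -(bracket x - bracket (locRadius q lam))) =
        lam⁻¹ * Real.exp (-q * bracket x) := by
      rw [← hexp, ← Real.exp_add]
      ring_nf
    rw [← e1, ← e2]
    rcases abs_cases (bracket x - bracket (locRadius q lam)) with ⟨h, _⟩ | ⟨h, _⟩
    · rw [h]; exact le_add_of_nonneg_right (Real.exp_pos _).le
    · rw [h]; exact le_add_of_nonneg_left (Real.exp_pos _).le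
  calc _ ≤ ∫⁻ x, ENNReal.ofReal (lam * (Real.exp (q * bracket x) * ‖laguerreFun b n k x‖ ^ 2) +
        lam⁻¹ * (Real.exp (-q * bracket x) * ‖laguerreFun b n k x‖ ^ 2)) :=
        lintegral_mono fun x => ENNReal.ofReal_le_ofReal (hle x)
    _ = ENNReal.ofReal (lam * expMoment b n q k + lam⁻¹ * expMoment b n (-q) k) := by
        rw [← ofReal_integral_eq_lintegral_ofReal hi (Eventually.of_forall fun x => by
          positivity), integral_add
          ((integrable_exp_bracket_mul_laguerreFun n hb k q).const_mul lam)
          ((integrable_exp_bracket_mul_laguerreFun n hb k (-q)).const_mul lam⁻¹),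
          integral_const_mul, integral_const_mul, expMoment, expMoment]
    _ ≤ _ := by
        rw [← hlam, inv_mul_cancel₀ hpos.ne']
        gcongr

theorem isUGWB_laguerreLp {q : ℝ} (hq : 0 < q) :
    IsUGWB q hq (levelProj b n) (laguerreLp hb n) := by
  refine ⟨isStarProjection_starProjection, ⟨q + 1, by linarith,
    isExpLocalized_levelProj hb n (by linarith)⟩, ?_⟩
  obtain ⟨lam, m, e, hm, hanti, hlim, hlam⟩ := exists_decreasing_listing
    (fun k => expMoment_pos n hb (-q) k) (tendsto_expMoment_neg n hb hq)
  obtain ⟨M, hM⟩ := exists_expMoment_mul_le n hb hq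
  refine ⟨lam, m, e, fun i j => laguerreLp hb n (e ⟨i, j⟩), fun _ _ => rfl, hm, fun i => ?_, hanti,
    hlim, orthonormal_laguerreLp hb n, ?_, fun i j => ?_, fun i j => ?_, M + 1, fun i j => ?_⟩
  · rw [← hlam ⟨i, ⟨0, hm i⟩⟩]
    exact expMoment_pos n hb _ _
  · rw [topologicalClosure_span_laguerreLp, levelProj, Submodule.range_starProjection]
  · rw [sandwich_laguerreLp, eigenvalue_eq_expMoment n hb, hlam]
  · refine (memLp_exp_bracket_mul_laguerreFun n hb (e ⟨i, j⟩) q).ae_eq ?_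
    filter_upwards [coeFn_laguerreLp hb n (e ⟨i, j⟩)] with x hx
    rw [hx]
  · refine le_trans (le_of_eq (lintegral_congr_ae ?_))
      (lintegral_localization_le n hb hq (e ⟨i, j⟩) (hM _))
    filter_upwards [coeFn_laguerreLp hb n (e ⟨i, j⟩)] with x hx
    rw [hx, hlam]

end eigenvalues

end

end Landau

/-- Let `b > 0`, `q > 0`, `n ∈ ℕ`. The Laguerre functions `φ_{n,k}`, `k ≥ -n`, are square integrable
eigenfunctions of `W_n = P_n e^{-q⟨X⟩} P_n` for the explicit eigenvalues `λ_{n,k}`, and they form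
an ultra-generalized Wannier basis for the range of `P_n`. -/
theorem proposition3p1 (b q : ℝ) (hb : 0 < b) (hq : 0 < q) (n : ℕ) :
    ∃ Φ : Landau.Index n → Landau.L2 2,
      (∀ k, (Φ k : Landau.Space 2 → ℂ) =ᵐ[volume] Landau.laguerreFun b n k) ∧
      (∀ k, IntegrableOn (Landau.eigenIntegrand b q n k) (Set.Ioi 0) volume) ∧
      (∀ k, Landau.sandwich q hq (Landau.levelProj b n) (Φ k) =
        (Landau.eigenvalue b q n k : ℂ) • Φ k) ∧
      Landau.IsUGWB q hq (Landau.levelProj b n) Φ :=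
  ⟨Landau.laguerreLp hb n, Landau.coeFn_laguerreLp hb n,
    Landau.integrableOn_eigenIntegrand n hb q, Landau.sandwich_laguerreLp hb n hq,
    Landau.isUGWB_laguerreLp hb n hq⟩
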